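/- Let $n\ge 1$ and $[n]=\{1,\dots,n\}$. For matroids $M,N$ on $[n]$ let $M\vee N$ be the matroid union (its independent sets are the sets $I\cup J$ with $I$ independent in $M$ and $J$ independent in $N$) and let $M\wedge N=(M^*\vee N^*)^*$ be the matroid intersection. For $1\le r\le n$ let $\mathfrak C_{r,n}$ be the set of chains of sets $\emptyset\subsetneq F_1\subsetneq\dots\subsetneq F_r=[n]$, let $\mathbb M^{\mathrm{free}}_{r,n}$ be the free $\mathbb Z$-module on the set of loopfree matroids of rank $r$ on $[n]$, and let $\Phi_{r,n}\colon \mathbb M^{\mathrm{free}}_{r,n}\to\mathbb Z^{\mathfrak C_{r,n}}$ be the homomorphism that sends $M$ to the indicator vector of those chains in $\mathfrak C_{r,n}$ all of whose members are flats of $M$. Put $\mathbb M_{r,n}=\mathbb M^{\mathrm{free}}_{r,n}/\ker\Phi_{r,n}$ and $\mathbb M_n=\bigoplus_{r=1}^n\mathbb M_{r,n}$. This is a commutative ring with unit $U_{n,n}$, where the product of the classes of two loopfree matroids $M,N$ is the class of $M\wedge N$ if $M\wedge N$ is loopfree, and $0$ otherwise. For $G\subseteq[n]$ with $|G|\le n-2$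 let $H_G=U_{|G|,G}\oplus U_{|G^c|-1,G^c}$ be the loopfree corank one matroid with set of coloops $G$. Then $\mathbb M_n$ is generated in corank one: as a $\mathbb Z$-algebra it is generated by the classes of the loopfree matroids of rank $n-1$ on $[n]$. More precisely, the class in $\mathbb M_n$ of every loopfree matroid on $[n]$ is a $\mathbb Z$-linear combination of (possibly empty) products $H_{G_1}\cdots H_{G_k}$ of corank one matroids, where $|G_i|\le n-2$ for all $i$. -/

import Mathlib

/- Organisation. First union and intersection of matroids, uniform matroids and the corank one
matroids `H_G`. Then the proof that linear relations between the vectors of chains of flats are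
preserved by matroid intersection, so that the product of the intersection ring is well defined.
Last the ring `MatroidRing n` itself, with `cls M` the element given by a matroid `M` on `Fin n`. -/

namespace MatroidIntersection

open Set

/-- The union `M ∨ N`: its independent sets are the sets `I ∪ J` with `I` independent in `M` and `J`
independent in `N`. -/
noncomputable def union {α : Type*} [Finite α] (M N : Matroid α) : Matroid α :=
  (IndepMatroid.ofFinite (E := M.E ∪ N.E) (Set.toFinite _)
    (fun X => ∃ I J, M.Indep I ∧ N.Indep J ∧ X = I ∪ J)
    ⟨∅, ∅, M.empty_indep, N.empty_indep, by simp⟩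
    (by
      rintro X Y ⟨I, J, hI, hJ, rfl⟩ hXY
      refine ⟨I ∩ X, J ∩ X, hI.subset inter_subset_left, hJ.subset inter_subset_left, ?_⟩
      rw [← union_inter_distrib_right, inter_eq_self_of_subset_right hXY])
    (by
      intro X Y hX hY hlt
      obtain ⟨I₂, J₂, hI₂, hJ₂, rfl, hd₂⟩ :
          ∃ I J, M.Indep I ∧ N.Indep J ∧ Y = I ∪ J ∧ Disjoint I J := by
        obtain ⟨I, J, hI, hJ, rfl⟩ := hY
        exact ⟨I, J \ I, hI, hJ.subset sdiff_subset, by simp, disjoint_sdiff_right⟩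
      by_contra! hcon
      have key : ∀ k : ℕ, ∃ I J, M.Indep I ∧ N.Indep J ∧ X = I ∪ J ∧ Disjoint I J ∧
          k ≤ (I ∩ I₂).ncard + (J ∩ J₂).ncard := by
        intro k
        induction k with
        | zero =>
          obtain ⟨I, J, hI, hJ, rfl⟩ := hX
          exact ⟨I, J \ I, hI, hJ.subset sdiff_subset, by simp, disjoint_sdiff_right, by simp⟩
        | succ k ih =>
          obtain ⟨I, J, hI, hJ, rfl, hd, hk⟩ := ih
          rw [ncard_union_eq hd, ncard_union_eq hd₂] at hlt
          have hc : I.ncard < I₂.ncard ∨ J.ncard < J₂.ncard := by omega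
          have fin (Z : Set α) : Z.Finite := Set.toFinite Z
          rcases hc with hc | hc
          · obtain ⟨x, hx, hxi⟩ := hI.exists_insert_of_encard_lt hI₂ (by
              rw [← (fin I).cast_ncard_eq, ← (fin I₂).cast_ncard_eq]; exact_mod_cast hc)
            have hxJ : x ∈ J := by
              by_contra hxJ
              refine hcon x (Or.inl hx.1) (by simp [hx.2, hxJ])
                (insert x I) J hxi hJ (by rw [insert_union])
            have hxJ₂ : x ∉ J₂ := fun h => hd₂.le_bot ⟨hx.1, h⟩
            refine ⟨insert x I, J \ {x}, hxi, hJ.subset sdiff_subset, ?_, ?_, ?_⟩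
            · ext z; by_cases hz : z = x <;> simp [hz, hxJ]
            · rw [Set.disjoint_left] at hd ⊢
              rintro z (rfl | hz) <;> simp_all
            · have h1 : (insert x I) ∩ I₂ = insert x (I ∩ I₂) := by
                rw [insert_inter_of_mem hx.1]
              have h2 : (J \ {x}) ∩ J₂ = J ∩ J₂ := by
                ext z; by_cases hz : z = x <;> simp [hz, hxJ₂]
              rw [h1, h2, ncard_insert_of_notMem (by simp [hx.2]) (fin _)]
              omega
          · obtain ⟨x, hx, hxi⟩ := hJ.exists_insert_of_encard_lt hJ₂ (by
              rw [← (fin J).cast_ncard_eq, ← (fin J₂).cast_ncard_eq]; exact_mod_cast hc)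
            have hxI : x ∈ I := by
              by_contra hxI
              refine hcon x (Or.inr hx.1) (by simp [hx.2, hxI])
                I (insert x J) hI hxi (by rw [union_insert])
            have hxI₂ : x ∉ I₂ := fun h => hd₂.le_bot ⟨h, hx.1⟩
            refine ⟨I \ {x}, insert x J, hI.subset sdiff_subset, hxi, ?_, ?_, ?_⟩
            · ext z; by_cases hz : z = x <;> simp [hz, hxI]
            · rw [Set.disjoint_right] at hd ⊢
              rintro z (rfl | hz) <;> simp_all
            · have h1 : (insert x J) ∩ J₂ = insert x (J ∩ J₂) := by
                rw [insert_inter_of_mem hx.1]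
              have h2 : (I \ {x}) ∩ I₂ = I ∩ I₂ := by
                ext z; by_cases hz : z = x <;> simp [hz, hxI₂]
              rw [h1, h2, ncard_insert_of_notMem (by simp [hx.2]) (fin _)]
              omega
      obtain ⟨I, J, -, -, -, -, hk⟩ := key (I₂.ncard + J₂.ncard + 1)
      have h1 := ncard_le_ncard (inter_subset_right : I ∩ I₂ ⊆ I₂) (Set.toFinite _)
      have h2 := ncard_le_ncard (inter_subset_right : J ∩ J₂ ⊆ J₂) (Set.toFinite _)
      omega)
    (by
      rintro X ⟨I, J, hI, hJ, rfl⟩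
      exact union_subset_union hI.subset_ground hJ.subset_ground)).matroid

/-- The intersection `M ∧ N = (M* ∨ N*)*`. -/
noncomputable def inter {α : Type*} [Finite α] (M N : Matroid α) : Matroid α :=
  (union M✶ N✶)✶

/-- The uniform matroid of rank `min k |S|` on the ground set `S`. -/
noncomputable def unif {α : Type*} [Finite α] (k : ℕ) (S : Set α) : Matroid α :=
  (IndepMatroid.ofFinite (E := S) (Set.toFinite _) (fun I => I ⊆ S ∧ I.ncard ≤ k)
    (by simp)
    (fun I J hJ hIJ => ⟨hIJ.trans hJ.1, (ncard_le_ncard hIJ (Set.toFinite _)).trans hJ.2⟩)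
    (by
      intro I J hI hJ hlt
      obtain ⟨e, heJ, heI⟩ := exists_mem_notMem_of_ncard_lt_ncard hlt (Set.toFinite _)
      refine ⟨e, heJ, heI, insert_subset (hJ.1 heJ) hI.1, ?_⟩
      rw [ncard_insert_of_notMem heI (Set.toFinite _)]
      have := hJ.2
      omega)
    (fun I hI => hI.1)).matroid

theorem unif_ground {α : Type*} [Finite α] (k : ℕ) (S : Set α) : (unif k S).E = S := rfl

theorem unif_indep {α : Type*} [Finite α] {k : ℕ} {S I : Set α} :
    (unif k S).Indep I ↔ I ⊆ S ∧ I.ncard ≤ k := Iff.rfl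

/-- The corank one matroid `H_G = U_{|G|, G} ⊕ U_{|Gᶜ| - 1, Gᶜ}`. -/
noncomputable def corankOne {α : Type*} [Finite α] (G : Set α) : Matroid α :=
  (unif G.ncard G).disjointSum (unif (Gᶜ.ncard - 1) Gᶜ)
    (by rw [unif_ground, unif_ground]; exact disjoint_compl_right)

section Basic

variable {α : Type*} [Finite α]

theorem union_indep {M N : Matroid α} {X : Set α} :
    (union M N).Indep X ↔ ∃ I J, M.Indep I ∧ N.Indep J ∧ X = I ∪ J := Iff.rfl

theorem union_ground (M N : Matroid α) : (union M N).E = M.E ∪ N.E := rfl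

theorem inter_ground {M N : Matroid α} (hM : M.E = univ) (hN : N.E = univ) :
    (inter M N).E = univ := by
  simp [inter, union_ground, hM, hN]

theorem union_comm' (M N : Matroid α) : union M N = union N M := by
  refine Matroid.ext_indep (by simp [union_ground, Set.union_comm]) fun X _ => ?_
  simp only [union_indep]
  constructor <;> rintro ⟨I, J, hI, hJ, rfl⟩ <;> exact ⟨J, I, hJ, hI, Set.union_comm _ _⟩

theorem union_assoc' (M N P : Matroid α) : union (union M N) P = union M (union N P) := by
  refine Matroid.ext_indep (by simp [union_ground, Set.union_assoc]) fun X _ => ?_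
  simp only [union_indep]
  constructor
  · rintro ⟨_, K, ⟨I, J, hI, hJ, rfl⟩, hK, rfl⟩
    exact ⟨I, J ∪ K, hI, ⟨J, K, hJ, hK, rfl⟩, Set.union_assoc _ _ _⟩
  · rintro ⟨I, _, hI, ⟨J, K, hJ, hK, rfl⟩, rfl⟩
    exact ⟨I ∪ J, K, ⟨I, J, hI, hJ, rfl⟩, hK, (Set.union_assoc _ _ _).symm⟩

theorem inter_comm' (M N : Matroid α) : inter M N = inter N M := by
  rw [inter, union_comm', inter]

theorem inter_assoc' (M N P : Matroid α) : inter (inter M N) P = inter M (inter N P) := by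
  simp [inter, union_assoc']

theorem inter_free {M : Matroid α} (hM : M.E = univ) : inter M (Matroid.freeOn univ) = M := by
  suffices h : union M✶ (Matroid.loopyOn univ) = M✶ by
    rw [inter, Matroid.freeOn_dual_eq, h, Matroid.dual_dual]
  refine Matroid.ext_indep (by simp [union_ground, hM]) fun X _ => ?_
  simp [union_indep]

theorem spanning_iff_compl {M : Matroid α} (hM : M.E = univ) {S : Set α} :
    M.Spanning S ↔ M✶.Indep Sᶜ := by
  rw [Matroid.spanning_iff_compl_coindep (by simp [hM]), hM, compl_eq_univ_sdiff,
    Matroid.coindep_def]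

theorem inter_spanning {M N : Matroid α} (hM : M.E = univ) (hN : N.E = univ) {R : Set α} :
    (inter M N).Spanning R ↔ ∃ S T, M.Spanning S ∧ N.Spanning T ∧ R = S ∩ T := by
  rw [spanning_iff_compl (inter_ground hM hN), inter, Matroid.dual_dual, union_indep]
  constructor
  · rintro ⟨I, J, hI, hJ, h⟩
    refine ⟨Iᶜ, Jᶜ, ?_, ?_, ?_⟩
    · rwa [spanning_iff_compl hM, compl_compl]
    · rwa [spanning_iff_compl hN, compl_compl]
    · rw [← compl_union, ← h, compl_compl]
  · rintro ⟨S, T, hS, hT, rfl⟩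
    exact ⟨Sᶜ, Tᶜ, (spanning_iff_compl hM).1 hS, (spanning_iff_compl hN).1 hT, compl_inter _ _⟩

theorem spanning_mono {M : Matroid α} (hM : M.E = univ) {S T : Set α} (h : M.Spanning S)
    (hST : S ⊆ T) : M.Spanning T := h.superset hST (by simp [hM])

theorem notMem_closure_iff {M : Matroid α} (hM : M.E = univ) {F : Set α} {x : α} :
    x ∉ M.closure F ↔ ∃ T, F ⊆ T ∧ ¬ M.Spanning T ∧ M.Spanning (insert x T) := by
  constructor
  · intro hx
    obtain ⟨I, hI⟩ := M.exists_isBasis F (by simp [hM])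
    have hxI : x ∉ M.closure I := by rwa [hI.closure_eq_closure]
    have hi : M.Indep (insert x I) := by
      rw [hI.indep.insert_indep_iff]; exact Or.inl ⟨by simp [hM], hxI⟩
    obtain ⟨B, hB, hIB⟩ := hi.exists_isBase_superset
    have hxI' : x ∉ I := fun h => hxI (M.subset_closure I (by simp [hM]) h)
    have hIB' : I ⊆ B \ {x} := fun y hy =>
      ⟨hIB (Or.inr hy), fun h => hxI' (by rw [← show y = x from h]; exact hy)⟩
    refine ⟨F ∪ (B \ {x}), subset_union_left, fun hs => ?_, ?_⟩
    · have h1 : M.closure (F ∪ (B \ {x})) = M.closure (B \ {x}) := by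
        rw [← Matroid.closure_union_congr_left hI.closure_eq_closure,
          union_eq_self_of_subset_left hIB']
      have h2 := hB.indep.notMem_closure_sdiff_of_mem (hIB (Or.inl rfl))
      rw [← h1, hs.closure_eq, hM] at h2
      exact h2 trivial
    · refine spanning_mono hM hB.spanning fun y hy => ?_
      by_cases hyx : y = x
      · exact Or.inl hyx
      · exact Or.inr (Or.inr ⟨hy, hyx⟩)
  · rintro ⟨T, hFT, hT, hxT⟩ hx
    apply hT
    have := M.closure_insert_eq_of_mem_closure (M.closure_subset_closure hFT hx)
    rw [Matroid.spanning_iff_closure_eq (by simp [hM])] at hxT ⊢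
    rw [← this, hxT]

theorem isFlat_iff {M : Matroid α} (hM : M.E = univ) {F : Set α} :
    M.IsFlat F ↔ ∀ x, x ∉ F → x ∉ M.closure F := by
  rw [Matroid.isFlat_iff_closure_eq]
  constructor
  · intro h x hx; rwa [h]
  · intro h
    exact (M.subset_closure F (by simp [hM])).antisymm' fun x hx => by
      by_contra hxF; exact h x hxF hx

theorem isFlat_iff_spanning {M : Matroid α} (hM : M.E = univ) {F : Set α} :
    M.IsFlat F ↔ ∀ x, x ∉ F → ∃ T, F ⊆ T ∧ ¬ M.Spanning T ∧ M.Spanning (insert x T) := by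
  simp only [isFlat_iff hM, notMem_closure_iff hM]

theorem loopless_iff {M : Matroid α} : M.Loopless ↔ M.IsFlat ∅ := by
  rw [Matroid.isFlat_iff_closure_eq]
  exact ⟨fun h => h.1, fun h => ⟨h⟩⟩

/-- If `M ∧ N` is loopfree then so is `M`. -/
theorem loopless_of_inter {M N : Matroid α} (hM : M.E = univ) (hN : N.E = univ)
    (h : (inter M N).Loopless) : M.Loopless := by
  rw [loopless_iff, isFlat_iff_spanning (inter_ground hM hN)] at h
  rw [loopless_iff, isFlat_iff_spanning hM]
  intro x hx
  obtain ⟨T, -, hT, hxT⟩ := h x hx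
  rw [inter_spanning hM hN] at hxT
  obtain ⟨U, V, hU, hV, hUV⟩ := hxT
  refine ⟨U \ {x}, empty_subset _, fun hs => hT ?_, spanning_mono hM hU (by simp)⟩
  rw [inter_spanning hM hN]
  refine ⟨(U \ {x}) ∪ T, V ∪ T, spanning_mono hM hs subset_union_left,
    spanning_mono hN hV subset_union_left, ?_⟩
  ext y
  have := Set.ext_iff.1 hUV y
  simp only [mem_insert_iff, mem_inter_iff] at this
  simp only [mem_inter_iff, mem_union, mem_sdiff, mem_singleton_iff]
  tauto

theorem corankOne_ground (G : Set α) : (corankOne G).E = univ := by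
  rw [corankOne, Matroid.disjointSum_ground_eq, unif_ground, unif_ground, union_compl_self]

theorem corankOne_spanning {G : Set α} (hG : Gᶜ.Nonempty) {S : Set α} :
    (corankOne G).Spanning S ↔ ∃ a ∈ Gᶜ, insert a S = univ := by
  have hind : ∀ I, (corankOne G).Indep I ↔ (I ∩ Gᶜ).ncard ≤ Gᶜ.ncard - 1 := by
    intro I
    rw [corankOne, Matroid.disjointSum_indep_iff, unif_ground, unif_ground, unif_indep, unif_indep]
    have := ncard_le_ncard (inter_subset_right : I ∩ G ⊆ G) (Set.toFinite _)
    simp [this]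
  have hpos : 0 < Gᶜ.ncard := (ncard_pos (Set.toFinite _)).2 hG
  have hind2 : ∀ I, (corankOne G).Indep I ↔ ∃ a ∈ Gᶜ, a ∉ I := by
    intro I
    rw [hind]
    constructor
    · intro h
      by_contra! hc
      rw [inter_eq_self_of_subset_right hc] at h
      omega
    · rintro ⟨a, ha, haI⟩
      have : (I ∩ Gᶜ).ncard < Gᶜ.ncard :=
        ncard_lt_ncard ⟨inter_subset_right, fun h => haI (h ha).1⟩ (Set.toFinite _)
      omega
  have hE := corankOne_ground G
  rw [Matroid.spanning_iff_exists_isBase_subset (by simp [hE])]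
  constructor
  · rintro ⟨B, hB, hBS⟩
    obtain ⟨a, ha, haB⟩ := (hind2 B).1 hB.indep
    refine ⟨a, ha, eq_univ_of_univ_subset fun y _ => ?_⟩
    have hi : (corankOne G).Indep (univ \ {a}) := (hind2 _).2 ⟨a, ha, by simp⟩
    have := hB.eq_of_subset_indep hi (fun z hz => ⟨trivial, fun h => haB (by
      rw [← show z = a from h]; exact hz)⟩)
    by_cases hy : y = a
    · exact Or.inl hy
    · exact Or.inr (hBS (this ▸ ⟨trivial, hy⟩))
  · rintro ⟨a, ha, h⟩
    have hi : (corankOne G).Indep (univ \ {a}) := (hind2 _).2 ⟨a, ha, by simp⟩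
    refine ⟨univ \ {a}, ?_, fun y hy => ?_⟩
    · rw [Matroid.isBase_iff_maximal_indep]
      refine ⟨hi, fun J hJ hle => ?_⟩
      obtain ⟨b, hb, hbJ⟩ := (hind2 J).1 hJ
      intro y hy
      refine ⟨trivial, fun hya => ?_⟩
      have hba : b = a := by
        by_contra hba; exact hbJ (hle ⟨trivial, hba⟩)
      exact hbJ (hba ▸ (show y = a from hya) ▸ hy)
    · have : y ∈ insert a S := h ▸ trivial
      exact this.resolve_left hy.2

end Basic

end MatroidIntersection

namespace MatroidIntersection

open Set

section Flags

/-- The rank of a matroid as a natural number. -/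
noncomputable def rk {α : Type*} (M : Matroid α) : ℕ := M.eRank.toNat

open Classical in
/-- The indicator of "`C` is a complete chain of flats of `M`, from `∅` to the ground set". -/
noncomputable def flagInd {α : Type*} (M : Matroid α) (C : Finset (Set α)) : ℤ :=
  if (IsChain (· ⊆ ·) (C : Set (Set α)) ∧ ∅ ∈ C ∧ univ ∈ C) ∧ C.card = rk M + 1 ∧
    ∀ F ∈ C, M.IsFlat F then 1 else 0

theorem closure_sub {α : Type*} {M : Matroid α} {F X : Set α} (hF : M.IsFlat F) (h : X ⊆ F) :
    M.closure X ⊆ F :=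
  (M.closure_subset_closure h).trans hF.closure.subset

variable {α : Type*} [Finite α]

theorem coe_rk (M : Matroid α) : (rk M : ℕ∞) = M.eRank := by
  refine ENat.coe_toNat ?_
  have := M.eRank_le_encard_ground
  have h2 : M.E.encard < ⊤ := (Set.toFinite M.E).encard_lt_top
  exact (this.trans_lt h2).ne

theorem rk_eq_of_isBase {M : Matroid α} {B : Set α} (hB : M.IsBase B) : rk M = B.ncard := by
  rw [rk, ← hB.encard_eq_eRank]; rfl

theorem rk_le_of_spanning {M : Matroid α} {S : Set α} (hS : M.Spanning S) : rk M ≤ S.ncard := by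
  obtain ⟨B, hB, hBS⟩ := hS.exists_isBase_subset
  rw [rk_eq_of_isBase hB]
  exact ncard_le_ncard hBS (Set.toFinite _)

theorem exists_spanning (M : Matroid α) : ∃ S, M.Spanning S ∧ S.ncard = rk M := by
  obtain ⟨B, hB⟩ := M.exists_isBase
  exact ⟨B, hB.spanning, (rk_eq_of_isBase hB).symm⟩

theorem flag_card_le {M : Matroid α} {C : Finset (Set α)}
    (hC : IsChain (· ⊆ ·) (C : Set (Set α))) (hF : ∀ F ∈ C, M.IsFlat F) : C.card ≤ rk M + 1 := by
  rw [← Finset.card_range (rk M + 1)]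
  have hco : ∀ X, ((M.eRk X).toNat : ℕ∞) = M.eRk X := fun X => ENat.coe_toNat
    (((M.eRk_le_encard X).trans_lt (Set.toFinite X).encard_lt_top).ne)
  refine Finset.card_le_card_of_injOn (fun F => (M.eRk F).toNat) ?_ ?_
  · intro F _
    have h : M.eRk F ≤ M.eRank := M.eRk_le_eRank F
    rw [← hco, ← coe_rk] at h
    have h' : (M.eRk F).toNat ≤ rk M := by exact_mod_cast h
    simpa [Nat.lt_succ_iff] using h'
  · have main : ∀ F ∈ C, ∀ G ∈ C, F ⊆ G → (M.eRk F).toNat = (M.eRk G).toNat → F = G := by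
      intro F hFC G hGC hFG h
      have hr : M.IsRkFinite F := M.isRkFinite_of_finite (Set.toFinite F)
      have hG : M.IsRkFinite G := M.isRkFinite_of_finite (Set.toFinite G)
      have he : M.eRk G ≤ M.eRk F := by
        rw [← hco F, h, hco G]
      have := hr.closure_eq_closure_of_subset_of_eRk_ge_eRk hFG he
      rwa [(hF F hFC).closure, (hF G hGC).closure] at this
    intro F hFC G hGC h
    rcases hC.total hFC hGC with h1 | h1
    · exact main F hFC G hGC h1 h
    · exact (main G hGC F hFC h1 h.symm).symm

/-- The intersection of `P` with the corank one matroid whose only circuit is `A`. -/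
noncomputable def trunc (A : Set α) (P : Matroid α) : Matroid α := inter P (corankOne Aᶜ)

theorem trunc_ground {A : Set α} {P : Matroid α} (hP : P.E = univ) : (trunc A P).E = univ :=
  inter_ground hP (corankOne_ground _)

theorem trunc_spanning {A : Set α} (hA : A.Nonempty) {P : Matroid α} (hP : P.E = univ) {S : Set α} :
    (trunc A P).Spanning S ↔ ∃ a ∈ A, P.Spanning (insert a S) := by
  rw [trunc, inter_spanning hP (corankOne_ground _)]
  simp only [corankOne_spanning (show (Aᶜᶜ).Nonempty by rwa [compl_compl]), compl_compl]
  constructor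
  · rintro ⟨U, V, hU, ⟨a, ha, hV⟩, rfl⟩
    refine ⟨a, ha, spanning_mono hP hU fun y hy => ?_⟩
    have : y ∈ insert a V := hV ▸ trivial
    exact this.imp id fun h => ⟨hy, h⟩
  · rintro ⟨a, ha, h⟩
    refine ⟨insert a S, S ∪ {a}ᶜ, h, ⟨a, ha, ?_⟩, ?_⟩
    · ext y; by_cases hy : y = a <;> simp [hy]
    · ext y; by_cases hy : y = a <;> simp [hy]

theorem trunc_isFlat {A : Set α} (hA : A.Nonempty) {P : Matroid α} (hP : P.E = univ) {F : Set α} :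
    (trunc A P).IsFlat F ↔
      P.IsFlat F ∧ ∀ e ∈ A, e ∉ F → ¬ A ⊆ P.closure (insert e F) := by
  rw [isFlat_iff_spanning (trunc_ground hP)]
  simp only [trunc_spanning hA hP]
  have sub : ∀ X, X ⊆ P.closure X := fun X => P.subset_closure X (by simp [hP])
  have spc : ∀ {b X}, b ∈ P.closure X → P.Spanning (insert b X) → P.Spanning X := by
    intro b X hb h
    rw [Matroid.spanning_iff_closure_eq (by simp [hP])] at h ⊢
    rw [← P.closure_insert_eq_of_mem_closure hb, h]
  constructor
  · intro h
    refine ⟨(isFlat_iff hP).2 fun x hx hxc => ?_, fun e he heF hAc => ?_⟩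
    · obtain ⟨T, hFT, hT, b, hb, hs⟩ := h x hx
      refine hT ⟨b, hb, ?_⟩
      rw [insert_comm] at hs
      exact spc (P.closure_subset_closure (hFT.trans (subset_insert _ _)) hxc) hs
    · obtain ⟨T, hFT, hT, b, hb, hs⟩ := h e heF
      exact hT ⟨e, he, spc (P.closure_subset_closure (insert_subset_insert hFT) (hAc hb)) hs⟩
  · rintro ⟨hF, hcov⟩ x hx
    have hxc : x ∉ P.closure F := by rwa [hF.closure]
    by_cases hAF : A ⊆ F
    · obtain ⟨T, hFT, hT, hs⟩ := (notMem_closure_iff hP).1 hxc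
      obtain ⟨a, ha⟩ := hA
      refine ⟨T, hFT, ?_, a, ha, spanning_mono hP hs (subset_insert _ _)⟩
      rintro ⟨b, hb, h⟩
      rw [insert_eq_of_mem (hFT (hAF hb))] at h
      exact hT h
    · have hAx : ¬ A ⊆ P.closure (insert x F) := by
        intro hAx
        obtain ⟨b, hb, hbF⟩ := not_subset.1 hAF
        refine hcov b hb hbF ?_
        rwa [P.closure_insert_congr (e := b) (f := x) ⟨hAx hb, by rwa [hF.closure]⟩]
      obtain ⟨b, hb, hbx⟩ := not_subset.1 hAx
      obtain ⟨T, hFT, hT, hs⟩ := (notMem_closure_iff hP).1 hbx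
      -- a basis of `F`, extended by `x` and `b`
      obtain ⟨I, hI⟩ := P.exists_isBasis F (by simp [hP])
      have hxI : P.Indep (insert x I) := by
        rw [hI.indep.insert_indep_iff]
        exact Or.inl ⟨by simp [hP], by rwa [hI.closure_eq_closure]⟩
      have hbI : P.Indep (insert b (insert x I)) := by
        rw [hxI.insert_indep_iff]
        refine Or.inl ⟨by simp [hP], ?_⟩
        rwa [← P.closure_insert_closure_eq_closure_insert, hI.closure_eq_closure,
          P.closure_insert_closure_eq_closure_insert]
      obtain ⟨B, hB, hIB⟩ := hbI.exists_isBase_superset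
      have hxI' : x ∉ I := fun h => hxc (by
        rw [← hI.closure_eq_closure]; exact sub _ h)
      have hbx' : b ∉ insert x F := fun h => hbx (sub _ h)
      have hbI' : b ∉ I := fun h => hbx' (Or.inr (hI.subset h))
      have hne : b ≠ x := fun h => hbx' (Or.inl h)
      have hBx : x ∈ B := hIB (by simp)
      have hBb : b ∈ B := hIB (by simp)
      have hcl : ∀ a, P.closure (insert a (F ∪ B \ {x, b})) = P.closure (insert a (B \ {x, b})) := by
        intro a
        have hIs : I ⊆ B \ {x, b} := fun y hy => ⟨hIB (by simp [hy]), by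
          rintro (h | h)
          · exact hxI' (h ▸ hy)
          · exact hbI' ((show y = b from h) ▸ hy)⟩
        rw [← P.closure_insert_closure_eq_closure_insert,
          ← Matroid.closure_union_congr_left hI.closure_eq_closure,
          union_eq_self_of_subset_left hIs, P.closure_insert_closure_eq_closure_insert]
      refine ⟨F ∪ B \ {x, b}, subset_union_left, ?_, b, hb, ?_⟩
      · rintro ⟨a, ha, h⟩
        have h2 : P.Spanning (insert a (B \ {x, b})) := by
          rw [Matroid.spanning_iff_closure_eq (by simp [hP])] at h ⊢
          rw [← hcl, h]
        have h3 := rk_le_of_spanning h2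
        have h4 := ncard_insert_le a (B \ {x, b})
        have h5 : (B \ {x, b}).ncard + 2 = B.ncard := by
          rw [← ncard_pair hne.symm]
          exact ncard_sdiff_add_ncard_of_subset (by
            rintro y (rfl | rfl) <;> assumption) (Set.toFinite _)
        rw [rk_eq_of_isBase hB] at h3
        omega
      · refine spanning_mono hP hB.spanning fun y hy => ?_
        by_cases h1 : y = x
        · simp [h1]
        by_cases h2 : y = b
        · simp [h2]
        · simp [h1, h2, hy]

theorem trunc_rk {A : Set α} (hA : A.Nonempty) {P : Matroid α} (hP : P.E = univ)
    (hl : P.Loopless) : rk (trunc A P) + 1 = rk P := by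
  apply le_antisymm
  · obtain ⟨a, ha⟩ := hA
    have hi : P.Indep {a} := by
      rw [Matroid.indep_singleton]; exact Matroid.isNonloop_of_loopless (by simp [hP])
    obtain ⟨B, hB, haB⟩ := hi.exists_isBase_superset
    have haB' : a ∈ B := haB rfl
    have : (trunc A P).Spanning (B \ {a}) := (trunc_spanning ⟨a, ha⟩ hP).2
      ⟨a, ha, by rw [insert_sdiff_singleton, insert_eq_of_mem haB']; exact hB.spanning⟩
    have h := rk_le_of_spanning this
    have h2 := ncard_sdiff_singleton_add_one haB' (Set.toFinite B)
    rw [rk_eq_of_isBase hB]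
    omega
  · obtain ⟨S, hS, hc⟩ := exists_spanning (trunc A P)
    obtain ⟨a, ha, h⟩ := (trunc_spanning hA hP).1 hS
    have := rk_le_of_spanning h
    have h2 := ncard_insert_le a S
    omega

theorem flagInd_trunc {A : Set α} (hA : A.Nonempty) (C : Finset (Set α)) :
    ∃ (S : Finset (Set α)) (f : Set α → Finset (Set α)), ∀ P : Matroid α, P.E = univ →
      flagInd (trunc A P) C = ∑ H ∈ S, flagInd P (f H) := by
  classical
  by_cases hC : (IsChain (· ⊆ ·) (C : Set (Set α)) ∧ ∅ ∈ C ∧ univ ∈ C)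
  swap
  · exact ⟨∅, fun _ => ∅, fun P _ => by simp [flagInd, hC]⟩
  obtain ⟨hch, h0, h1⟩ := hC
  -- the largest member of the chain that does not contain `A`
  obtain ⟨D, hDC, hAD, hmax⟩ : ∃ D ∈ C, ¬ A ⊆ D ∧ ∀ F ∈ C, ¬ A ⊆ F → F ⊆ D := by
    obtain ⟨D, hD⟩ := (C.filter (fun F => ¬ A ⊆ F)).exists_maximal
      ⟨∅, by simp [h0, Set.subset_empty_iff, hA.ne_empty]⟩
    have hD1 := Finset.mem_filter.1 hD.prop
    refine ⟨D, hD1.1, hD1.2, fun F hF hAF => ?_⟩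
    rcases hch.total hF hD1.1 with h | h
    · exact h
    · exact hD.le_of_ge (Finset.mem_filter.2 ⟨hF, hAF⟩) h
  obtain ⟨e, heA, heD⟩ := not_subset.1 hAD
  set S : Finset (Set α) := (Set.toFinite {H : Set α | insert e D ⊆ H ∧ ¬ A ⊆ H ∧
    ∀ F ∈ C, A ⊆ F → H ⊆ F}).toFinset with hSdef
  have hS : ∀ H, H ∈ S ↔ insert e D ⊆ H ∧ ¬ A ⊆ H ∧ ∀ F ∈ C, A ⊆ F → H ⊆ F := by
    intro H; simp [hSdef]
  refine ⟨S, fun H => insert H C, fun P hP => ?_⟩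
  -- general facts on members of `S`
  have hnot : ∀ H ∈ S, H ∉ C := by
    intro H hH hHC
    have h := (hS H).1 hH
    exact heD (hmax H hHC h.2.1 (h.1 (Or.inl rfl)))
  have hchain : ∀ H ∈ S, IsChain (· ⊆ ·) ((insert H C : Finset (Set α)) : Set (Set α)) := by
    intro H hH
    have h := (hS H).1 hH
    rw [Finset.coe_insert]
    refine hch.insert fun F hF _ => ?_
    by_cases hAF : A ⊆ F
    · exact Or.inl (h.2.2 F hF hAF)
    · exact Or.inr ((hmax F hF hAF).trans ((subset_insert _ _).trans h.1))
  by_cases hT : C.card = rk (trunc A P) + 1 ∧ ∀ F ∈ C, (trunc A P).IsFlat F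
  · obtain ⟨hcard, hfl⟩ := hT
    simp only [trunc_isFlat hA hP] at hfl
    have hl : P.Loopless := loopless_iff.2 (hfl ∅ h0).1
    have hrk := trunc_rk hA hP hl
    set H := P.closure (insert e D) with hHdef
    have hHS : H ∈ S := by
      refine (hS H).2 ⟨P.subset_closure _ (by simp [hP]), (hfl D hDC).2 e heA heD, ?_⟩
      intro F hF hAF
      refine closure_sub (hfl F hF).1 (insert_subset (hAF heA) ?_)
      rcases hch.total hF hDC with h | h
      · exact absurd (hAF.trans h) hAD
      · exact h
    have hHf : ∀ F ∈ insert H C, P.IsFlat F := by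
      intro F hF
      rcases Finset.mem_insert.1 hF with rfl | hF
      · exact P.isFlat_closure _
      · exact (hfl F hF).1
    rw [Finset.sum_eq_single H]
    · rw [flagInd, flagInd, if_pos, if_pos]
      · exact ⟨⟨hchain H hHS, Finset.mem_insert_of_mem h0, Finset.mem_insert_of_mem h1⟩, by
          rw [Finset.card_insert_of_notMem (hnot H hHS)]; omega, hHf⟩
      · exact ⟨⟨hch, h0, h1⟩, hcard, fun F hF => (trunc_isFlat hA hP).2 (hfl F hF)⟩
    · intro K hK hKH
      rw [flagInd, if_neg]
      rintro ⟨-, -, hKf⟩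
      have hKfl := hKf K (Finset.mem_insert_self _ _)
      have hHK : H ⊆ K := by
        exact closure_sub hKfl ((hS K).1 hK).1
      have hbig : IsChain (· ⊆ ·) ((insert K (insert H C) : Finset (Set α)) : Set (Set α)) := by
        rw [Finset.coe_insert]
        refine (hchain H hHS).insert fun F hF hne => ?_
        rcases Finset.mem_insert.1 hF with rfl | hF
        · exact Or.inr hHK
        · exact hchain K hK (by simp) (by simp [Finset.mem_coe.1 hF]) hne
      have := flag_card_le hbig (M := P) (by
        intro F hF
        rcases Finset.mem_insert.1 hF with rfl | hF
        · exact hKfl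
        · exact hHf F hF)
      rw [Finset.card_insert_of_notMem (by simp [hKH, hnot K hK]),
        Finset.card_insert_of_notMem (hnot H hHS)] at this
      omega
    · exact fun h => absurd hHS h
  · rw [flagInd, if_neg (fun h => hT h.2), eq_comm]
    refine Finset.sum_eq_zero fun H hH => ?_
    rw [flagInd, if_neg]
    rintro ⟨-, hcard, hfl⟩
    apply hT
    have hfl' : ∀ F ∈ C, P.IsFlat F := fun F hF => hfl F (Finset.mem_insert_of_mem hF)
    have hrk := trunc_rk hA hP (loopless_iff.2 (hfl' ∅ h0))
    rw [Finset.card_insert_of_notMem (hnot H hH)] at hcard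
    refine ⟨by omega, fun F hF => (trunc_isFlat hA hP).2 ⟨hfl' F hF, fun b hb hbF hA' => ?_⟩⟩
    have h := (hS H).1 hH
    have hFD : F ⊆ D := hmax F hF fun hAF => hbF (hAF hb)
    have heF : e ∉ P.closure F := by rw [(hfl' F hF).closure]; exact fun h => heD (hFD h)
    rw [← P.closure_insert_congr ⟨hA' heA, heF⟩] at hA'
    refine h.2.1 (hA'.trans ?_)
    exact closure_sub (hfl H (Finset.mem_insert_self _ _)) <| (insert_subset_insert hFD).trans h.1

/-- A linear relation between the flag vectors of a family of matroids. -/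
def FlagRel {ι : Type*} (s : Finset ι) (a : ι → ℤ) (M : ι → Matroid α) : Prop :=
  ∀ C, ∑ i ∈ s, a i * flagInd (M i) C = 0

theorem FlagRel.trunc {ι : Type*} {s : Finset ι} {a : ι → ℤ} {P : ι → Matroid α}
    (hP : ∀ i, (P i).E = univ) (h : FlagRel s a P) {A : Set α} (hA : A.Nonempty) :
    FlagRel s a (fun i => trunc A (P i)) := by
  intro C
  obtain ⟨S, f, hf⟩ := flagInd_trunc hA C
  simp only [fun i => hf (P i) (hP i), Finset.mul_sum]
  rw [Finset.sum_comm]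
  exact Finset.sum_eq_zero fun H _ => h (f H)

end Flags

end MatroidIntersection

namespace MatroidIntersection

open Set

section Doubling

variable {α : Type*} [Finite α]

theorem sum_ground' {β : Type*} {M : Matroid α} {N : Matroid β} (hM : M.E = univ)
    (hN : N.E = univ) : (M.sum N).E = univ := by
  rw [Matroid.sum_ground, hM, hN, image_univ, image_univ, range_inl_union_range_inr]

theorem sum_spanning {M N : Matroid α} (hM : M.E = univ) (hN : N.E = univ) {S : Set (α ⊕ α)} :
    (M.sum N).Spanning S ↔ M.Spanning (Sum.inl ⁻¹' S) ∧ N.Spanning (Sum.inr ⁻¹' S) := by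
  rw [Matroid.spanning_iff_exists_isBase_subset (by rw [sum_ground' hM hN]; exact subset_univ _),
    Matroid.spanning_iff_exists_isBase_subset (by simp [hM]),
    Matroid.spanning_iff_exists_isBase_subset (by simp [hN])]
  simp only [Matroid.sum_isBase_iff]
  constructor
  · rintro ⟨B, ⟨h1, h2⟩, hB⟩
    exact ⟨⟨_, h1, preimage_mono hB⟩, ⟨_, h2, preimage_mono hB⟩⟩
  · rintro ⟨⟨B, hB, hBS⟩, B', hB', hBS'⟩
    refine ⟨Sum.inl '' B ∪ Sum.inr '' B', ?_, ?_⟩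
    · have h1 : Sum.inl ⁻¹' (Sum.inl '' B ∪ Sum.inr '' B' : Set (α ⊕ α)) = B := by ext; simp
      have h2 : Sum.inr ⁻¹' (Sum.inl '' B ∪ Sum.inr '' B' : Set (α ⊕ α)) = B' := by ext; simp
      rw [h1, h2]
      exact ⟨hB, hB'⟩
    · exact union_subset (image_subset_iff.2 hBS) (image_subset_iff.2 hBS')

theorem sum_isFlat {M N : Matroid α} (hM : M.E = univ) (hN : N.E = univ) {F : Set (α ⊕ α)} :
    (M.sum N).IsFlat F ↔ M.IsFlat (Sum.inl ⁻¹' F) ∧ N.IsFlat (Sum.inr ⁻¹' F) := by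
  rw [isFlat_iff_spanning (sum_ground' hM hN), isFlat_iff_spanning hM, isFlat_iff_spanning hN]
  simp only [sum_spanning hM hN]
  have e1 : ∀ (x : α) (T : Set (α ⊕ α)), Sum.inl ⁻¹' (insert (Sum.inl x) T) =
      insert x (Sum.inl ⁻¹' T) := fun x T => by ext; simp
  have e2 : ∀ (x : α) (T : Set (α ⊕ α)), Sum.inr ⁻¹' (insert (Sum.inl x) T) = Sum.inr ⁻¹' T :=
    fun x T => by ext; simp
  have e3 : ∀ (x : α) (T : Set (α ⊕ α)), Sum.inr ⁻¹' (insert (Sum.inr x) T) =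
      insert x (Sum.inr ⁻¹' T) := fun x T => by ext; simp
  have e4 : ∀ (x : α) (T : Set (α ⊕ α)), Sum.inl ⁻¹' (insert (Sum.inr x) T) = Sum.inl ⁻¹' T :=
    fun x T => by ext; simp
  have f1 : ∀ T T' : Set α, Sum.inl ⁻¹' (Sum.inl '' T ∪ Sum.inr '' T' : Set (α ⊕ α)) = T :=
    fun T T' => by ext; simp
  have f2 : ∀ T T' : Set α, Sum.inr ⁻¹' (Sum.inl '' T ∪ Sum.inr '' T' : Set (α ⊕ α)) = T' :=
    fun T T' => by ext; simp
  have hMu : M.Spanning univ := hM ▸ M.ground_spanning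
  have hNu : N.Spanning univ := hN ▸ N.ground_spanning
  constructor
  · intro h
    refine ⟨fun x hx => ?_, fun x hx => ?_⟩
    · obtain ⟨T, hFT, hT, hs⟩ := h (Sum.inl x) hx
      rw [e1, e2] at hs
      exact ⟨Sum.inl ⁻¹' T, preimage_mono hFT, fun h => hT ⟨h, hs.2⟩, hs.1⟩
    · obtain ⟨T, hFT, hT, hs⟩ := h (Sum.inr x) hx
      rw [e3, e4] at hs
      exact ⟨Sum.inr ⁻¹' T, preimage_mono hFT, fun h => hT ⟨hs.1, h⟩, hs.2⟩
  · rintro ⟨h1, h2⟩ (x | x) hx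
    · obtain ⟨T, hFT, hT, hs⟩ := h1 x hx
      refine ⟨Sum.inl '' T ∪ Sum.inr '' univ, ?_, ?_, ?_⟩
      · rintro (y | y) hy
        · exact Or.inl ⟨y, hFT hy, rfl⟩
        · exact Or.inr ⟨y, trivial, rfl⟩
      · rw [f1]; exact fun h => hT h.1
      · rw [e1, e2, f1, f2]; exact ⟨hs, hNu⟩
    · obtain ⟨T, hFT, hT, hs⟩ := h2 x hx
      refine ⟨Sum.inl '' univ ∪ Sum.inr '' T, ?_, ?_, ?_⟩
      · rintro (y | y) hy
        · exact Or.inl ⟨y, trivial, rfl⟩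
        · exact Or.inr ⟨y, hFT hy, rfl⟩
      · rw [f2]; exact fun h => hT h.2
      · rw [e3, e4, f1, f2]; exact ⟨hMu, hs⟩

theorem sum_rk (M N : Matroid α) : rk (M.sum N) = rk M + rk N := by
  obtain ⟨B, hB⟩ := (M.sum N).exists_isBase
  rw [rk_eq_of_isBase hB]
  rw [Matroid.sum_isBase_iff] at hB
  rw [rk_eq_of_isBase hB.1, rk_eq_of_isBase hB.2]
  have h : B = Sum.inl '' (Sum.inl ⁻¹' B) ∪ Sum.inr '' (Sum.inr ⁻¹' B) := by
    ext (y | y) <;> simp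
  conv_lhs => rw [h]
  rw [ncard_union_eq (by
    rw [Set.disjoint_left]; rintro _ ⟨x, -, rfl⟩ ⟨y, -, h⟩; exact absurd h (by simp)),
    ncard_image_of_injective _ Sum.inl_injective, ncard_image_of_injective _ Sum.inr_injective]

open Classical in
theorem chain_card_le {C : Finset (Set (α ⊕ α))} (hC : IsChain (· ⊆ ·) (C : Set (Set (α ⊕ α))))
    (h0 : ∅ ∈ C) : C.card + 1 ≤ (C.image (Sum.inl ⁻¹' ·)).card + (C.image (Sum.inr ⁻¹' ·)).card := by
  set C₁ := C.image (Sum.inl ⁻¹' ·) with hC₁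
  set C₂ := C.image (Sum.inr ⁻¹' ·) with hC₂
  let f : Set (α ⊕ α) → ℕ := fun X =>
    (C₁.filter (· ⊂ Sum.inl ⁻¹' X)).card + (C₂.filter (· ⊂ Sum.inr ⁻¹' X)).card
  have mono : ∀ (D : Finset (Set α)) {X Y : Set α}, X ⊆ Y →
      (D.filter (· ⊂ X)).card ≤ (D.filter (· ⊂ Y)).card := fun D X Y h =>
    Finset.card_le_card fun Z hZ => by
      rw [Finset.mem_filter] at hZ ⊢; exact ⟨hZ.1, hZ.2.trans_subset h⟩
  have smono : ∀ (D : Finset (Set α)) {X Y : Set α}, X ∈ D → X ⊂ Y →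
      (D.filter (· ⊂ X)).card < (D.filter (· ⊂ Y)).card := fun D X Y hX h => by
    refine Finset.card_lt_card ⟨fun Z hZ => ?_, fun hs => ?_⟩
    · rw [Finset.mem_filter] at hZ ⊢; exact ⟨hZ.1, hZ.2.trans h⟩
    · have := hs (Finset.mem_filter.2 ⟨hX, h⟩)
      exact (Finset.mem_filter.1 this).2.ne rfl
  have bound : ∀ (D : Finset (Set α)) {X : Set α}, X ∈ D → (D.filter (· ⊂ X)).card < D.card :=
    fun D X hX => Finset.card_lt_card ⟨Finset.filter_subset _ _, fun hs =>
      (Finset.mem_filter.1 (hs hX)).2.ne rfl⟩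
  have m1 : ∀ X ∈ C, Sum.inl ⁻¹' X ∈ C₁ := fun X hX => Finset.mem_image_of_mem _ hX
  have m2 : ∀ X ∈ C, Sum.inr ⁻¹' X ∈ C₂ := fun X hX => Finset.mem_image_of_mem _ hX
  have strict : ∀ X ∈ C, ∀ Y ∈ C, X ⊆ Y → f X = f Y → X = Y := by
    intro X hX Y hY hXY hf
    have s1 : (Sum.inl ⁻¹' X : Set α) ⊆ Sum.inl ⁻¹' Y := preimage_mono hXY
    have s2 : (Sum.inr ⁻¹' X : Set α) ⊆ Sum.inr ⁻¹' Y := preimage_mono hXY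
    have l1 := mono C₁ s1
    have l2 := mono C₂ s2
    have hf' : (C₁.filter (· ⊂ Sum.inl ⁻¹' X)).card + (C₂.filter (· ⊂ Sum.inr ⁻¹' X)).card =
      (C₁.filter (· ⊂ Sum.inl ⁻¹' Y)).card + (C₂.filter (· ⊂ Sum.inr ⁻¹' Y)).card := hf
    have e1 : (Sum.inl ⁻¹' X : Set α) = Sum.inl ⁻¹' Y := by
      by_contra hne
      have := smono C₁ (m1 X hX) (s1.ssubset_of_ne hne)
      omega
    have e2 : (Sum.inr ⁻¹' X : Set α) = Sum.inr ⁻¹' Y := by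
      by_contra hne
      have := smono C₂ (m2 X hX) (s2.ssubset_of_ne hne)
      omega
    ext (z | z)
    · exact Set.ext_iff.1 e1 z
    · exact Set.ext_iff.1 e2 z
  have p1 := bound C₁ (m1 ∅ h0)
  have p2 := bound C₂ (m2 ∅ h0)
  have : C.card ≤ (Finset.range (C₁.card + C₂.card - 1)).card := by
    refine Finset.card_le_card_of_injOn f ?_ ?_
    · intro X hX
      have b1 := bound C₁ (m1 X hX)
      have b2 := bound C₂ (m2 X hX)
      have : f X < C₁.card + C₂.card - 1 := by
        change (C₁.filter _).card + (C₂.filter _).card < _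
        omega
      simpa using this
    · intro X hX Y hY h
      rcases hC.total hX hY with h' | h'
      · exact strict X hX Y hY h' h
      · exact (strict Y hY X hX h' h.symm).symm
  rw [Finset.card_range] at this
  omega

open Classical in
theorem flagInd_sum {M N : Matroid α} (hM : M.E = univ) (hN : N.E = univ)
    (C : Finset (Set (α ⊕ α))) :
    flagInd (M.sum N) C =
      (if (IsChain (· ⊆ ·) (C : Set (Set (α ⊕ α))) ∧ ∅ ∈ C ∧ univ ∈ C) ∧
        C.card + 1 = (C.image (Sum.inl ⁻¹' ·)).card + (C.image (Sum.inr ⁻¹' ·)).card then 1 else 0) *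
      flagInd N (C.image (Sum.inr ⁻¹' ·)) * flagInd M (C.image (Sum.inl ⁻¹' ·)) := by
  by_cases hC : IsChain (· ⊆ ·) (C : Set (Set (α ⊕ α))) ∧ ∅ ∈ C ∧ univ ∈ C
  swap
  · rw [if_neg (fun h => hC h.1), flagInd, if_neg (fun h => hC h.1)]; simp
  have hle := chain_card_le hC.1 hC.2.1
  set C₁ := C.image (Sum.inl ⁻¹' ·) with hC₁
  set C₂ := C.image (Sum.inr ⁻¹' ·) with hC₂
  have c1 : IsChain (· ⊆ ·) (C₁ : Set (Set α)) ∧ ∅ ∈ C₁ ∧ univ ∈ C₁ := by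
    refine ⟨?_, Finset.mem_image.2 ⟨∅, hC.2.1, rfl⟩, Finset.mem_image.2 ⟨univ, hC.2.2, rfl⟩⟩
    intro X hX Y hY _
    obtain ⟨X', hX', rfl⟩ := Finset.mem_image.1 hX
    obtain ⟨Y', hY', rfl⟩ := Finset.mem_image.1 hY
    exact (hC.1.total hX' hY').imp (fun h => preimage_mono h) (fun h => preimage_mono h)
  have c2 : IsChain (· ⊆ ·) (C₂ : Set (Set α)) ∧ ∅ ∈ C₂ ∧ univ ∈ C₂ := by
    refine ⟨?_, Finset.mem_image.2 ⟨∅, hC.2.1, rfl⟩, Finset.mem_image.2 ⟨univ, hC.2.2, rfl⟩⟩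
    intro X hX Y hY _
    obtain ⟨X', hX', rfl⟩ := Finset.mem_image.1 hX
    obtain ⟨Y', hY', rfl⟩ := Finset.mem_image.1 hY
    exact (hC.1.total hX' hY').imp (fun h => preimage_mono h) (fun h => preimage_mono h)
  have hfl : (∀ F ∈ C, (M.sum N).IsFlat F) ↔ (∀ F ∈ C₁, M.IsFlat F) ∧ ∀ F ∈ C₂, N.IsFlat F := by
    simp only [sum_isFlat hM hN, hC₁, hC₂, Finset.forall_mem_image]
    exact ⟨fun h => ⟨fun F hF => (h F hF).1, fun F hF => (h F hF).2⟩,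
      fun h F hF => ⟨h.1 hF, h.2 hF⟩⟩
  simp only [flagInd, hC, c1, c2, hfl, sum_rk, true_and]
  by_cases h1 : ∀ F ∈ C₁, M.IsFlat F
  swap
  · simp [h1]
  by_cases h2 : ∀ F ∈ C₂, N.IsFlat F
  swap
  · simp [h2]
  have b1 := flag_card_le c1.1 h1
  have b2 := flag_card_le c2.1 h2
  simp only [iff_true_intro h1, iff_true_intro h2, and_true]
  by_cases h : C.card = rk M + rk N + 1
  · rw [if_pos h, if_pos (by omega), if_pos (by omega), if_pos (by omega)]; simp
  · rw [if_neg h]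
    by_cases h3 : C₁.card = rk M + 1
    · by_cases h4 : C₂.card = rk N + 1
      · rw [if_neg (by omega)]; simp
      · simp [h4]
    · simp [h3]

/-- Successive intersection with the corank one matroids of circuit `{inl e, inr e}`. -/
noncomputable def diag (l : List α) (P : Matroid (α ⊕ α)) : Matroid (α ⊕ α) :=
  l.foldr (fun e Q => trunc {Sum.inl e, Sum.inr e} Q) P

theorem diag_ground (l : List α) {P : Matroid (α ⊕ α)} (hP : P.E = univ) :
    (diag l P).E = univ := by
  induction l with
  | nil => exact hP
  | cons e l ih => exact trunc_ground ih

theorem FlagRel.diag {ι : Type*} {s : Finset ι} {a : ι → ℤ} {P : ι → Matroid (α ⊕ α)}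
    (hP : ∀ i, (P i).E = univ) (h : FlagRel s a P) (l : List α) :
    FlagRel s a (fun i => diag l (P i)) := by
  induction l with
  | nil => exact h
  | cons e l ih => exact ih.trunc (fun i => diag_ground l (hP i)) ⟨_, Or.inl rfl⟩

theorem diag_spanning {l : List α} (hl : l.Nodup) {P : Matroid (α ⊕ α)} (hP : P.E = univ)
    {S : Set (α ⊕ α)} :
    (diag l P).Spanning S ↔ ∃ Z : Set (α ⊕ α), (∀ e, ¬ (Sum.inl e ∈ Z ∧ Sum.inr e ∈ Z)) ∧
      (∀ z ∈ Z, Sum.elim id id z ∈ l) ∧ P.Spanning (S ∪ Z) := by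
  induction l generalizing S with
  | nil =>
    constructor
    · intro h
      exact ⟨∅, by simp, by simp, by rw [union_empty]; exact h⟩
    · rintro ⟨Z, -, hZ, h⟩
      have : Z = ∅ := eq_empty_of_forall_notMem fun z hz => by simpa using hZ z hz
      rw [this, union_empty] at h
      exact h
  | cons e l ih =>
    rw [List.nodup_cons] at hl
    have := trunc_spanning (A := {Sum.inl e, Sum.inr e}) ⟨_, Or.inl rfl⟩ (diag_ground l hP) (S := S)
    change (MatroidIntersection.trunc {Sum.inl e, Sum.inr e} (diag l P)).Spanning S ↔ _
    rw [this]
    simp only [ih hl.2]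
    constructor
    · rintro ⟨a, ha, Z, h1, h2, h3⟩
      have hz1 : Sum.inl e ∉ Z := fun h => hl.1 (h2 _ h)
      have hz2 : Sum.inr e ∉ Z := fun h => hl.1 (h2 _ h)
      refine ⟨insert a Z, fun x => ?_, fun z hz => ?_, ?_⟩
      · rintro ⟨hx1, hx2⟩
        rcases ha with rfl | rfl
        · rcases hx2 with hx2 | hx2
          · simp at hx2
          · rcases hx1 with hx1 | hx1
            · obtain rfl := Sum.inl_injective hx1
              exact hz2 hx2
            · exact h1 x ⟨hx1, hx2⟩
        · rcases hx1 with hx1 | hx1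
          · simp at hx1
          · rcases hx2 with hx2 | hx2
            · obtain rfl := Sum.inr_injective hx2
              exact hz1 hx1
            · exact h1 x ⟨hx1, hx2⟩
      · rcases hz with rfl | hz
        · rcases ha with rfl | rfl <;> simp
        · exact List.mem_cons_of_mem _ (h2 z hz)
      · rwa [union_insert, ← insert_union]
    · rintro ⟨Z, h1, h2, h3⟩
      have h2' : ∀ z ∈ Z \ {Sum.inl e, Sum.inr e}, Sum.elim id id z ∈ l := by
        rintro (z | z) ⟨hz, hz'⟩
        · rcases List.mem_cons.1 (h2 _ hz) with h | h
          · exact absurd (Or.inl (by rw [← show z = e from h])) hz'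
          · exact h
        · rcases List.mem_cons.1 (h2 _ hz) with h | h
          · exact absurd (Or.inr (by rw [← show z = e from h]; rfl)) hz'
          · exact h
      by_cases he : Sum.inr e ∈ Z
      · refine ⟨Sum.inr e, Or.inr rfl, Z \ {Sum.inl e, Sum.inr e},
          fun x hx => h1 x ⟨hx.1.1, hx.2.1⟩, h2', spanning_mono hP h3 ?_⟩
        rintro z (hz | hz)
        · exact Or.inl (Or.inr hz)
        · by_cases hz' : z = Sum.inr e
          · exact Or.inl (Or.inl hz')
          · refine Or.inr ⟨hz, ?_⟩
            rintro (rfl | h)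
            · exact h1 e ⟨hz, he⟩
            · exact hz' h
      · refine ⟨Sum.inl e, Or.inl rfl, Z \ {Sum.inl e, Sum.inr e},
          fun x hx => h1 x ⟨hx.1.1, hx.2.1⟩, h2', spanning_mono hP h3 ?_⟩
        rintro z (hz | hz)
        · exact Or.inl (Or.inr hz)
        · by_cases hz' : z = Sum.inl e
          · exact Or.inl (Or.inl hz')
          · refine Or.inr ⟨hz, ?_⟩
            rintro (h | rfl)
            · exact hz' h
            · exact he hz

theorem diag_sum_spanning {M N : Matroid α} (hM : M.E = univ) (hN : N.E = univ) {l : List α}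
    (hl : l.Nodup) (hall : ∀ e, e ∈ l) {S : Set (α ⊕ α)} :
    (diag l (M.sum N)).Spanning S ↔ (inter M N).Spanning (Sum.elim id id '' S) := by
  have hπ : Sum.elim id id '' S = (Sum.inl ⁻¹' S ∪ Sum.inr ⁻¹' S : Set α) := by
    ext x
    constructor
    · rintro ⟨z | z, hz, rfl⟩
      · exact Or.inl hz
      · exact Or.inr hz
    · rintro (h | h)
      · exact ⟨_, h, rfl⟩
      · exact ⟨_, h, rfl⟩
  rw [diag_spanning hl (sum_ground' hM hN), inter_spanning hM hN, hπ]
  simp only [sum_spanning hM hN]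
  constructor
  · rintro ⟨Z, h1, -, h2, h3⟩
    refine ⟨Sum.inl ⁻¹' (S ∪ Z) ∪ Sum.inr ⁻¹' S, Sum.inr ⁻¹' (S ∪ Z) ∪ Sum.inl ⁻¹' S,
      spanning_mono hM h2 subset_union_left, spanning_mono hN h3 subset_union_left, ?_⟩
    ext x
    have := h1 x
    simp only [mem_union, mem_inter_iff, mem_preimage]
    tauto
  · rintro ⟨U, V, hU, hV, h⟩
    refine ⟨Sum.inl '' (U \ (Sum.inl ⁻¹' S)) ∪ Sum.inr '' (V \ (Sum.inr ⁻¹' S)), ?_,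
      fun z _ => hall _, spanning_mono hM hU ?_, spanning_mono hN hV ?_⟩
    · intro e he
      have := Set.ext_iff.1 h e
      simp at he this
      tauto
    · intro x hx
      simp
      tauto
    · intro x hx
      simp
      tauto

theorem diag_sum_rk {M N : Matroid α} (hM : M.E = univ) (hN : N.E = univ) {l : List α}
    (hl : l.Nodup) (hall : ∀ e, e ∈ l) : rk (diag l (M.sum N)) = rk (inter M N) := by
  apply le_antisymm
  · obtain ⟨S, hS, hc⟩ := exists_spanning (inter M N)
    have : (diag l (M.sum N)).Spanning (Sum.inl '' S) := by
      rw [diag_sum_spanning hM hN hl hall, image_image]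
      simpa using hS
    rw [← hc, ← ncard_image_of_injective S (Sum.inl_injective (β := α))]
    exact rk_le_of_spanning this
  · obtain ⟨S, hS, hc⟩ := exists_spanning (diag l (M.sum N))
    rw [← hc]
    exact (rk_le_of_spanning ((diag_sum_spanning hM hN hl hall).1 hS)).trans
      (ncard_image_le (Set.toFinite _))

theorem diag_sum_isFlat {M N : Matroid α} (hM : M.E = univ) (hN : N.E = univ) {l : List α}
    (hl : l.Nodup) (hall : ∀ e, e ∈ l) {F : Set α} :
    (diag l (M.sum N)).IsFlat (Sum.elim id id ⁻¹' F) ↔ (inter M N).IsFlat F := by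
  rw [isFlat_iff_spanning (diag_ground l (sum_ground' hM hN)),
    isFlat_iff_spanning (inter_ground hM hN)]
  simp only [diag_sum_spanning hM hN hl hall, image_insert_eq]
  have surj : Function.Surjective (Sum.elim id id : α ⊕ α → α) := fun x => ⟨Sum.inl x, rfl⟩
  constructor
  · intro h x hx
    obtain ⟨T, hFT, hT, hs⟩ := h (Sum.inl x) hx
    refine ⟨_, ?_, hT, hs⟩
    rw [← image_preimage_eq F surj]
    exact image_mono hFT
  · intro h z hz
    obtain ⟨T, hFT, hT, hs⟩ := h (Sum.elim id id z) hz
    refine ⟨Sum.elim id id ⁻¹' T, preimage_mono hFT, ?_, ?_⟩ <;> rwa [image_preimage_eq T surj]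

open Classical in
theorem flagInd_inter {M N : Matroid α} (hM : M.E = univ) (hN : N.E = univ) {l : List α}
    (hl : l.Nodup) (hall : ∀ e, e ∈ l) (C : Finset (Set α)) :
    flagInd (inter M N) C = flagInd (diag l (M.sum N)) (C.image (Sum.elim id id ⁻¹' ·)) := by
  have surj : Function.Surjective (Sum.elim id id : α ⊕ α → α) := fun x => ⟨Sum.inl x, rfl⟩
  have hinj : Function.Injective (fun F : Set α => (Sum.elim id id ⁻¹' F : Set (α ⊕ α))) :=
    surj.preimage_injective
  have hmem : ∀ F : Set α, (Sum.elim id id ⁻¹' F : Set (α ⊕ α)) ∈ C.image (Sum.elim id id ⁻¹' ·) ↔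
      F ∈ C := fun F => by
    rw [Finset.mem_image]
    exact ⟨fun ⟨G, hG, h⟩ => hinj h ▸ hG, fun h => ⟨F, h, rfl⟩⟩
  have h0 := hmem ∅
  have h1 := hmem univ
  rw [preimage_empty] at h0
  rw [preimage_univ] at h1
  have hch : IsChain (· ⊆ ·) ((C.image (Sum.elim id id ⁻¹' ·) : Finset (Set (α ⊕ α))) :
      Set (Set (α ⊕ α))) ↔ IsChain (· ⊆ ·) (C : Set (Set α)) := by
    constructor
    · intro h X hX Y hY hne
      have := h ((hmem X).2 hX) ((hmem Y).2 hY) (fun h => hne (hinj h))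
      simpa only [surj.preimage_subset_preimage_iff] using this
    · intro h X hX Y hY _
      obtain ⟨X', hX', rfl⟩ := Finset.mem_image.1 hX
      obtain ⟨Y', hY', rfl⟩ := Finset.mem_image.1 hY
      exact (h.total hX' hY').imp (fun h => preimage_mono h) (fun h => preimage_mono h)
  simp only [flagInd, h0, h1, hch, Finset.card_image_of_injective _ hinj,
    diag_sum_rk hM hN hl hall, Finset.forall_mem_image, diag_sum_isFlat hM hN hl hall]

/-- Linear relations between flag vectors are preserved by matroid intersection. -/
theorem FlagRel.inter {ι : Type*} {s : Finset ι} {a : ι → ℤ} {M : ι → Matroid α}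
    (hM : ∀ i, (M i).E = univ) (h : FlagRel s a M) {N : Matroid α} (hN : N.E = univ) :
    FlagRel s a (fun i => inter (M i) N) := by
  classical
  have := Fintype.ofFinite α
  have hl : (Finset.univ : Finset α).toList.Nodup := Finset.nodup_toList _
  have hall : ∀ e : α, e ∈ (Finset.univ : Finset α).toList := by simp
  have hsum : FlagRel s a (fun i => (M i).sum N) := by
    intro C
    simp only [fun i => flagInd_sum (hM i) hN C, mul_left_comm (a _), ← Finset.mul_sum]
    rw [h, mul_zero]
  intro C
  simp only [fun i => flagInd_inter (hM i) hN hl hall C]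
  exact hsum.diag (fun i => sum_ground' (hM i) hN) _ _

end Doubling

end MatroidIntersection

namespace MatroidIntersection

open Set DirectSum

section Ring

/-- The loopfree matroids of rank `r` on the labeled ground set `Fin n`. -/
abbrev LoopfreeMatroid (r n : ℕ) : Type :=
  {M : Matroid (Fin n) // M.E = univ ∧ M.Loopless ∧ M.eRank = r}

/-- The chains of sets `∅ ⊊ F₁ ⊊ ⋯ ⊊ F_r = E` of length `r`, given as the set
`{∅, F₁, …, F_r}` of their members. -/
abbrev Chains (r n : ℕ) : Type :=
  {C : Finset (Set (Fin n)) //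
    IsChain (· ⊆ ·) (C : Set (Set (Fin n))) ∧ ∅ ∈ C ∧ univ ∈ C ∧ C.card = r + 1}

open Classical in
/-- The indicator vector `v_M` of the chains of flats of `M`. -/
noncomputable def flagVector {r n : ℕ} (M : LoopfreeMatroid r n) : Chains r n → ℤ :=
  fun C => if ∀ F ∈ C.1, M.1.IsFlat F then 1 else 0

/-- The homomorphism `Φ_{r,n} : M ↦ v_M` on the free `ℤ`-module on loopfree matroids of rank `r`. -/
noncomputable def Phi (r n : ℕ) : (LoopfreeMatroid r n →₀ ℤ) →ₗ[ℤ] (Chains r n → ℤ) :=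
  Finsupp.linearCombination ℤ flagVector

/-- The graded piece `𝕄_{r,n}`: the free module modulo the kernel of `Φ_{r,n}`. -/
abbrev GradedPiece (r n : ℕ) : Type := (LoopfreeMatroid r n →₀ ℤ) ⧸ LinearMap.ker (Phi r n)

/-- The intersection ring of matroids `𝕄_n = ⨁_{r=1}^n 𝕄_{r,n}`. -/
def MatroidRing (n : ℕ) : Type := ⨁ r : Finset.Icc 1 n, GradedPiece r n

noncomputable instance (n : ℕ) : AddCommGroup (MatroidRing n) :=
  inferInstanceAs (AddCommGroup (⨁ r : Finset.Icc 1 n, GradedPiece r n))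

/-- The inclusion of a graded piece. -/
noncomputable def ofPiece {n : ℕ} (r : Finset.Icc 1 n) : GradedPiece r n →+ MatroidRing n :=
  DirectSum.of (fun r : Finset.Icc 1 n => GradedPiece r n) r

/-- The projection to a graded piece. -/
noncomputable def component {n : ℕ} (r : Finset.Icc 1 n) : MatroidRing n →+ GradedPiece r n :=
  DFinsupp.evalAddMonoidHom (β := fun r : Finset.Icc 1 n => GradedPiece r n) r

/-- The universal property of the direct sum. -/
noncomputable def liftPieces {n : ℕ} {A : Type*} [AddCommGroup A]
    (f : ∀ r : Finset.Icc 1 n, GradedPiece r n →+ A) : MatroidRing n →+ A :=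
  DirectSum.toAddMonoid f

theorem component_ofPiece {n : ℕ} (r : Finset.Icc 1 n) (x : GradedPiece r n) :
    component r (ofPiece r x) = x :=
  DirectSum.of_eq_same (β := fun r : Finset.Icc 1 n => GradedPiece r n) r x

theorem component_ofPiece_ne {n : ℕ} {r s : Finset.Icc 1 n} (h : s ≠ r) (x : GradedPiece s n) :
    component r (ofPiece s x) = 0 :=
  DirectSum.of_eq_of_ne (β := fun r : Finset.Icc 1 n => GradedPiece r n) s r x h.symm

theorem liftPieces_ofPiece {n : ℕ} {A : Type*} [AddCommGroup A]
    (f : ∀ r : Finset.Icc 1 n, GradedPiece r n →+ A) (r : Finset.Icc 1 n) (x : GradedPiece r n) :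
    liftPieces f (ofPiece r x) = f r x :=
  DirectSum.toAddMonoid_of (β := fun r : Finset.Icc 1 n => GradedPiece r n) f r x

theorem eq_zero_of_component {n : ℕ} {x : MatroidRing n} (h : ∀ r, component r x = 0) : x = 0 :=
  DFinsupp.ext (β := fun r : Finset.Icc 1 n => GradedPiece r n) h

theorem induction_pieces {n : ℕ} {p : MatroidRing n → Prop} (x : MatroidRing n) (h0 : p 0)
    (h : ∀ r x, p (ofPiece r x)) (hadd : ∀ x y, p x → p y → p (x + y)) : p x :=
  DirectSum.induction_on (β := fun r : Finset.Icc 1 n => GradedPiece r n) (motive := p) x h0 h hadd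

theorem LoopfreeMatroid.rk_eq {r n : ℕ} (M : LoopfreeMatroid r n) : rk M.1 = r := by
  rw [rk, M.2.2.2]; rfl

theorem rk_mem {n : ℕ} (hn : 1 ≤ n) {M : Matroid (Fin n)} (hM : M.E = univ) (hl : M.Loopless) :
    rk M ∈ Finset.Icc 1 n := by
  rw [Finset.mem_Icc]
  constructor
  · have hi : M.Indep {⟨0, hn⟩} := by
      rw [Matroid.indep_singleton]; exact Matroid.isNonloop_of_loopless (by simp [hM])
    obtain ⟨B, hB, hs⟩ := hi.exists_isBase_superset
    rw [rk_eq_of_isBase hB, Nat.one_le_iff_ne_zero, ← Nat.pos_iff_ne_zero,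
      ncard_pos (Set.toFinite _)]
    exact ⟨_, hs rfl⟩
  · have := rk_le_of_spanning M.ground_spanning
    rwa [hM, ncard_univ, Nat.card_eq_fintype_card, Fintype.card_fin] at this

open Classical in
/-- The element of `𝕄_n` given by a matroid `M` on `Fin n`: its class if `M` is loopfree, and `0`
if `M` has loops. (For `n ≥ 1` the rank of a loopfree matroid always lies in `{1, …, n}`.) -/
noncomputable def cls {n : ℕ} (M : Matroid (Fin n)) : MatroidRing n :=
  if h : M.E = univ ∧ M.Loopless ∧ rk M ∈ Finset.Icc 1 n then
    ofPiece ⟨rk M, h.2.2⟩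
      (Submodule.Quotient.mk (Finsupp.single ⟨M, h.1, h.2.1, (coe_rk M).symm⟩ 1))
  else 0

theorem cls_eq {r n : ℕ} (hr : r ∈ Finset.Icc 1 n) (M : LoopfreeMatroid r n) :
    cls M.1 = ofPiece ⟨r, hr⟩ (Submodule.Quotient.mk (Finsupp.single M 1)) := by
  obtain ⟨M, h⟩ := M
  obtain rfl : rk M = r := LoopfreeMatroid.rk_eq ⟨M, h⟩
  rw [cls, dif_pos ⟨h.1, h.2.1, hr⟩]

/-- The `C`-coordinate on a graded piece. -/
noncomputable def pieceCoord {r n : ℕ} (C : Chains r n) : GradedPiece r n →ₗ[ℤ] ℤ :=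
  (LinearMap.ker (Phi r n)).liftQ (LinearMap.proj C ∘ₗ Phi r n) (fun f hf => by
    rw [LinearMap.mem_ker] at hf ⊢
    rw [LinearMap.comp_apply, hf, map_zero])

theorem pieceCoord_mk {r n : ℕ} (C : Chains r n) (f : LoopfreeMatroid r n →₀ ℤ) :
    pieceCoord C (Submodule.Quotient.mk f) = Phi r n f C := rfl

/-- The `C`-coordinate of an element of `𝕄_n`. -/
noncomputable def coord {n : ℕ} (r : Finset.Icc 1 n) (C : Chains r n) : MatroidRing n →+ ℤ :=
  (pieceCoord C).toAddMonoidHom.comp (component r)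

theorem coord_apply {n : ℕ} (r : Finset.Icc 1 n) (C : Chains r n) (x : MatroidRing n) :
    coord r C x = pieceCoord C (component r x) := rfl

theorem eq_zero_of_coord {n : ℕ} {x : MatroidRing n} (h : ∀ r C, coord r C x = 0) : x = 0 := by
  refine eq_zero_of_component fun r => ?_
  obtain ⟨f, hf⟩ := Submodule.Quotient.mk_surjective _ (component r x)
  rw [← hf, Submodule.Quotient.mk_eq_zero, LinearMap.mem_ker]
  funext C
  have := h r C
  rw [coord_apply, ← hf] at this
  exact this

theorem flagInd_eq {r n : ℕ} (M : LoopfreeMatroid r n) (C : Chains r n) :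
    flagInd M.1 C.1 = flagVector M C := by
  have h1 := C.2
  have h2 := M.rk_eq
  by_cases h : ∀ F ∈ C.1, M.1.IsFlat F
  · rw [flagInd, flagVector, if_pos h,
      if_pos ⟨⟨h1.1, h1.2.1, h1.2.2.1⟩, by rw [h2, h1.2.2.2], h⟩]
  · rw [flagInd, flagVector, if_neg h, if_neg (fun h' => h h'.2.2)]

theorem cls_eq_zero {n : ℕ} {M : Matroid (Fin n)}
    (h : ¬ (M.E = univ ∧ M.Loopless ∧ rk M ∈ Finset.Icc 1 n)) : cls M = 0 := by
  rw [cls, dif_neg h]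

theorem coord_cls {n : ℕ} (r : Finset.Icc 1 n) (C : Chains r n) {M : Matroid (Fin n)}
    (hM : M.E = univ) : coord r C (cls M) = flagInd M C.1 := by
  by_cases hr : rk M = r ∧ M.Loopless
  · obtain ⟨hr, hl⟩ := hr
    let M' : LoopfreeMatroid r n := ⟨M, hM, hl, by rw [← coe_rk, hr]⟩
    have := cls_eq r.2 M'
    change coord r C (cls M'.1) = flagInd M'.1 C.1
    rw [this, coord_apply, component_ofPiece, pieceCoord_mk, Phi,
      Finsupp.linearCombination_single, one_smul, flagInd_eq]
  · have h0 : flagInd M C.1 = 0 := by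
      rw [flagInd, if_neg]
      rintro ⟨h1, h2, h3⟩
      exact hr ⟨by have := C.2.2.2.2; omega, loopless_iff.2 (h3 ∅ h1.2.1)⟩
    rw [h0]
    by_cases h : M.E = univ ∧ M.Loopless ∧ rk M ∈ Finset.Icc 1 n
    · have hne : (⟨rk M, h.2.2⟩ : Finset.Icc 1 n) ≠ r := fun he => hr ⟨by rw [← he], h.2.1⟩
      rw [cls, dif_pos h, coord_apply, component_ofPiece_ne hne, map_zero]
    · rw [cls_eq_zero h, map_zero]

theorem flagRel_of_ker {r n : ℕ} {f : LoopfreeMatroid r n →₀ ℤ} (hf : f ∈ LinearMap.ker (Phi r n)) :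
    FlagRel f.support f (fun M => M.1) := by
  intro C
  by_cases hC : IsChain (· ⊆ ·) (C : Set (Set (Fin n))) ∧ ∅ ∈ C ∧ univ ∈ C ∧ C.card = r + 1
  · have h := congrFun (LinearMap.mem_ker.1 hf) ⟨C, hC⟩
    rw [Phi, Finsupp.linearCombination_apply, Finsupp.sum, Finset.sum_apply] at h
    rw [← show (0 : Chains r n → ℤ) ⟨C, hC⟩ = 0 from rfl, ← h]
    exact Finset.sum_congr rfl fun M _ => by
      rw [flagInd_eq M ⟨C, hC⟩, Pi.smul_apply, smul_eq_mul]
  · refine Finset.sum_eq_zero fun M _ => ?_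
    rw [flagInd, if_neg, mul_zero]
    rintro ⟨h1, h2, -⟩
    rw [M.rk_eq] at h2
    exact hC ⟨h1.1, h1.2.1, h1.2.2, h2⟩

theorem sum_cls_inter {r n : ℕ} {f : LoopfreeMatroid r n →₀ ℤ} (hf : f ∈ LinearMap.ker (Phi r n))
    {N : Matroid (Fin n)} (hN : N.E = univ) :
    ∑ M ∈ f.support, f M • cls (inter M.1 N) = 0 := by
  refine eq_zero_of_coord fun s C => ?_
  have := (flagRel_of_ker hf).inter (fun M => M.2.1) hN C.1
  rw [map_sum, ← this]
  refine Finset.sum_congr rfl fun M _ => ?_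
  rw [map_zsmul, coord_cls _ _ (inter_ground M.2.1 hN), smul_eq_mul]

/-- Multiplication by a fixed matroid `M` on a graded piece. -/
noncomputable def mulPiece {s n : ℕ} (M : Matroid (Fin n)) (hM : M.E = univ) :
    GradedPiece s n →ₗ[ℤ] MatroidRing n :=
  (LinearMap.ker (Phi s n)).liftQ
    (Finsupp.linearCombination ℤ fun N : LoopfreeMatroid s n => cls (inter M N.1))
    (fun f hf => by
      rw [LinearMap.mem_ker, Finsupp.linearCombination_apply, Finsupp.sum]
      simp only [inter_comm' M]
      exact sum_cls_inter hf hM)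

theorem mulPiece_mk {s n : ℕ} {M : Matroid (Fin n)} (hM : M.E = univ)
    (f : LoopfreeMatroid s n →₀ ℤ) : mulPiece M hM (Submodule.Quotient.mk f) =
      Finsupp.linearCombination ℤ (fun N : LoopfreeMatroid s n => cls (inter M N.1)) f := rfl

/-- Multiplication by a fixed matroid `M`; it sends a matroid `N` to the class of `M ∧ N`. -/
noncomputable def mulLeft {n : ℕ} (M : Matroid (Fin n)) (hM : M.E = univ) :
    MatroidRing n →+ MatroidRing n :=
  liftPieces fun _ => (mulPiece M hM).toAddMonoidHom

theorem mulLeft_of {n : ℕ} {M : Matroid (Fin n)} (hM : M.E = univ) {s : ℕ}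
    (hs : s ∈ Finset.Icc 1 n) (N : LoopfreeMatroid s n) :
    mulLeft M hM (cls N.1) = cls (inter M N.1) := by
  rw [cls_eq hs N, mulLeft, liftPieces_ofPiece]
  refine (mulPiece_mk hM _).trans ?_
  rw [Finsupp.linearCombination_single, one_smul]

theorem mulLeft_cls {n : ℕ} {M N : Matroid (Fin n)} (hM : M.E = univ) (hN : N.E = univ) :
    mulLeft M hM (cls N) = cls (inter M N) := by
  by_cases h : N.Loopless ∧ rk N ∈ Finset.Icc 1 n
  · exact mulLeft_of hM h.2 ⟨N, hN, h.1, (coe_rk N).symm⟩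
  · rw [cls_eq_zero (fun h' => h h'.2), map_zero, cls_eq_zero]
    rintro ⟨-, hl, hr⟩
    rw [inter_comm'] at hl
    have hl' := loopless_of_inter hN hM hl
    rw [Finset.mem_Icc] at hr
    exact h ⟨hl', rk_mem (hr.1.trans hr.2) hN hl'⟩

theorem induction_cls {n : ℕ} {p : MatroidRing n → Prop} (x : MatroidRing n)
    (h : ∀ M : Matroid (Fin n), M.E = univ → p (cls M)) (h0 : p 0)
    (hadd : ∀ x y, p x → p y → p (x + y)) (hneg : ∀ x, p x → p (-x)) : p x := by
  have hz : ∀ (k : ℤ) (x : MatroidRing n), p x → p (k • x) := by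
    intro k x hx
    have hnat : ∀ m : ℕ, p (m • x) := fun m => by
      induction m with
      | zero => rwa [zero_smul]
      | succ m ih => rw [succ_nsmul]; exact hadd _ _ ih hx
    cases k with
    | ofNat m => simpa using hnat m
    | negSucc m => rw [negSucc_zsmul]; exact hneg _ (hnat _)
  refine induction_pieces x h0 (fun r y => ?_) hadd
  obtain ⟨f, rfl⟩ := Submodule.Quotient.mk_surjective _ y
  induction f using Finsupp.induction_linear with
  | zero => rw [Submodule.Quotient.mk_zero, map_zero]; exact h0
  | add f g hf hg => rw [Submodule.Quotient.mk_add, map_add]; exact hadd _ _ hf hg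
  | single M a =>
    have : Finsupp.single M a = a • Finsupp.single M (1 : ℤ) := by
      rw [Finsupp.smul_single, smul_eq_mul, mul_one]
    rw [this, Submodule.Quotient.mk_smul, map_zsmul]
    exact hz a _ (cls_eq r.2 M ▸ h M.1 M.2.1)

/-- The product with a fixed second factor, on a graded piece. -/
noncomputable def mulHomPiece (r n : ℕ) :
    GradedPiece r n →ₗ[ℤ] (MatroidRing n →+ MatroidRing n) :=
  (LinearMap.ker (Phi r n)).liftQ
    (Finsupp.linearCombination ℤ fun M : LoopfreeMatroid r n => mulLeft M.1 M.2.1)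
    (fun f hf => by
      rw [LinearMap.mem_ker, Finsupp.linearCombination_apply, Finsupp.sum]
      ext x
      induction x using induction_cls with
      | h N hN =>
        rw [AddMonoidHom.finsetSum_apply, AddMonoidHom.zero_apply, ← sum_cls_inter hf hN]
        exact Finset.sum_congr rfl fun M _ => by
          rw [← mulLeft_cls M.2.1 hN]; rfl
      | h0 => rw [map_zero, map_zero]
      | hadd x y hx hy => rw [map_add, map_add, hx, hy]
      | hneg x hx => rw [map_neg, map_neg, hx])

theorem mulHomPiece_mk {r n : ℕ} (f : LoopfreeMatroid r n →₀ ℤ) :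
    mulHomPiece r n (Submodule.Quotient.mk f) =
      Finsupp.linearCombination ℤ (fun M : LoopfreeMatroid r n => mulLeft M.1 M.2.1) f := rfl

/-- The product of `𝕄_n` as a biadditive map; it sends `(M, N)` to the class of `M ∧ N`. -/
noncomputable def mulHom (n : ℕ) : MatroidRing n →+ MatroidRing n →+ MatroidRing n :=
  liftPieces fun r => (mulHomPiece r n).toAddMonoidHom

theorem mulHom_cls {n : ℕ} {M N : Matroid (Fin n)} (hM : M.E = univ) (hN : N.E = univ) :
    mulHom n (cls M) (cls N) = cls (inter M N) := by
  by_cases h : M.Loopless ∧ rk M ∈ Finset.Icc 1 n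
  · let M' : LoopfreeMatroid (rk M) n := ⟨M, hM, h.1, (coe_rk M).symm⟩
    change mulHom n (cls M'.1) (cls N) = cls (inter M'.1 N)
    rw [cls_eq h.2 M', mulHom, liftPieces_ofPiece]
    change mulHomPiece _ n _ (cls N) = _
    rw [mulHomPiece_mk, Finsupp.linearCombination_single, one_smul, mulLeft_cls _ hN]
  · rw [cls_eq_zero (fun h' => h h'.2), map_zero, AddMonoidHom.zero_apply, cls_eq_zero]
    rintro ⟨-, hl, hr⟩
    have hl' := loopless_of_inter hM hN hl
    rw [Finset.mem_Icc] at hr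
    exact h ⟨hl', rk_mem (hr.1.trans hr.2) hM hl'⟩

noncomputable instance (n : ℕ) : Mul (MatroidRing n) := ⟨fun x y => mulHom n x y⟩

/-- The unit is the class of the free matroid `U_{n,n}`. -/
noncomputable instance (n : ℕ) : One (MatroidRing n) := ⟨cls (Matroid.freeOn univ)⟩

theorem mul_def {n : ℕ} (x y : MatroidRing n) : x * y = mulHom n x y := rfl

theorem one_def (n : ℕ) : (1 : MatroidRing n) = cls (Matroid.freeOn univ) := rfl

/-- `M · N` is `M ∧ N` if the latter is loopfree, and `0` otherwise. -/
theorem cls_mul_cls {n : ℕ} {M N : Matroid (Fin n)} (hM : M.E = univ) (hN : N.E = univ) :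
    cls M * cls N = cls (inter M N) := mulHom_cls hM hN

theorem mul_comm_aux {n : ℕ} (x y : MatroidRing n) : x * y = y * x := by
  simp only [mul_def]
  induction x using induction_cls with
  | h M hM =>
    induction y using induction_cls with
    | h N hN => rw [mulHom_cls hM hN, mulHom_cls hN hM, inter_comm']
    | h0 => simp
    | hadd x y hx hy => simp [hx, hy]
    | hneg x hx => simp [hx]
  | h0 => simp
  | hadd x y hx hy => simp [hx, hy]
  | hneg x hx => simp [hx]

theorem one_mul_aux {n : ℕ} (x : MatroidRing n) : 1 * x = x := by
  rw [mul_comm_aux]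
  simp only [mul_def, one_def]
  induction x using induction_cls with
  | h M hM => rw [mulHom_cls hM (by simp), inter_free hM]
  | h0 => simp
  | hadd x y hx hy => simp [hx, hy]
  | hneg x hx => simp [hx]

theorem mul_assoc_aux {n : ℕ} (x y z : MatroidRing n) : x * y * z = x * (y * z) := by
  simp only [mul_def]
  induction x using induction_cls with
  | h M hM =>
    induction y using induction_cls with
    | h N hN =>
      induction z using induction_cls with
      | h P hP =>
        rw [mulHom_cls hM hN, mulHom_cls hN hP, mulHom_cls (inter_ground hM hN) hP,
          mulHom_cls hM (inter_ground hN hP), inter_assoc']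
      | h0 => simp
      | hadd x y hx hy => simp [hx, hy]
      | hneg x hx => simp [hx]
    | h0 => simp
    | hadd x y hx hy => simp [hx, hy]
    | hneg x hx => simp [hx]
  | h0 => simp
  | hadd x y hx hy => simp [hx, hy]
  | hneg x hx => simp [hx]

noncomputable instance (n : ℕ) : CommRing (MatroidRing n) :=
  { (inferInstance : AddCommGroup (MatroidRing n)), (inferInstance : Mul (MatroidRing n)),
    (inferInstance : One (MatroidRing n)) with
    left_distrib := fun x y z => map_add (mulHom n x) y z
    right_distrib := fun x y z => by simp only [mul_def, map_add, AddMonoidHom.add_apply]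
    zero_mul := fun x => by simp only [mul_def, map_zero, AddMonoidHom.zero_apply]
    mul_zero := fun x => map_zero (mulHom n x)
    mul_assoc := mul_assoc_aux
    one_mul := one_mul_aux
    mul_one := fun x => by rw [mul_comm_aux, one_mul_aux]
    mul_comm := mul_comm_aux }

end Ring

end MatroidIntersection

/-! The proof is an induction on the corank. The free matroid is the unit. Any other matroid `M` is
an elementary quotient of `N = freeLift M`, the union of `M` with the uniform matroid of rank one,
and `N` has rank one higher (`isElementaryQuotient_freeLift`). An elementary quotient of `N` is
encoded by a modular cut. The principal cut of all sets containing a fixed nonempty `A` gives `trunc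
A N`, whose class is the product of the class of `N` with that of `corankOne Aᶜ`. It is therefore
enough to write the class of `M` as an integral combination of the classes of the matroids `trunc A
N`.

This is possible because each coordinate of the chain vector of an elementary quotient is linear in
the indicator function φ of its cut (`exists_linear_flagInd`). The relevant chains of flats of `N`
skip exactly one rank. If the gap lies between `D` and `D'`, and `S` is the set of flats strictly
between them, the coordinate is φ(D') + (|S| - 1) φ(D) - ∑ φ(F), summed over `F` in `S`. Modularity
enters because at most one member of `S` lies in a cut that omits `D`.

A cut is taken here as an upward closed family of arbitrary subsets, so Möbius inversion on the
Boolean lattice expands φ in the indicators of principal filters (`exists_sum_subset_eq`). The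
linear functional depends only on `N` and the chain, so the same coefficients express the class of
`M` through the classes of the `trunc A N`. The coefficient of the empty set vanishes, a singleton
`A` contributes zero because it creates a loop, and every other `A` has a complement of at most n -
2 elements. -/

namespace MatroidIntersection

open Set

/-! ### Elementary quotients, modular cuts, and linearity of chain vectors in the cut. -/

section ElementaryQuotient

variable {α : Type*}

/-- The rank of a set as a natural number. -/
noncomputable def setRk (N : Matroid α) (X : Set α) : ℕ := (N.eRk X).toNat

theorem setRk_empty (N : Matroid α) : setRk N ∅ = 0 := by
  rw [setRk, Matroid.eRk_empty]; rfl

theorem setRk_univ (N : Matroid α) : setRk N univ = rk N := by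
  rw [setRk, Matroid.eRk_univ_eq]; rfl

/-- The value of a function on sets at the gap between the flats `D` and `D'`. -/
noncomputable def gapValue (S : Finset (Set α)) (D D' : Set α) : (Set α → ℤ) →ₗ[ℤ] ℤ :=
  let ev : Set α → (Set α → ℤ) →ₗ[ℤ] ℤ := fun X => LinearMap.proj X
  ev D' + ((S.card : ℤ) - 1) • ev D - ∑ F ∈ S, ev F

theorem gapValue_apply (S : Finset (Set α)) (D D' : Set α) (φ : Set α → ℤ) :
    gapValue S D D' φ = φ D' + ((S.card : ℤ) - 1) * φ D - ∑ F ∈ S, φ F := by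
  simp [gapValue]

variable [Finite α]

theorem coe_setRk (N : Matroid α) (X : Set α) : (setRk N X : ℕ∞) = N.eRk X :=
  ENat.natCast_toNat ((N.eRk_le_encard X).trans_lt (Set.toFinite X).encard_lt_top).ne

theorem setRk_mono (N : Matroid α) {X Y : Set α} (h : X ⊆ Y) : setRk N X ≤ setRk N Y := by
  have := N.eRk_mono h
  rw [← coe_setRk, ← coe_setRk] at this
  exact_mod_cast this

theorem eq_of_setRk_le {N : Matroid α} {F G : Set α} (hF : N.IsFlat F) (hG : N.IsFlat G)
    (hFG : F ⊆ G) (h : setRk N G ≤ setRk N F) : F = G := by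
  have he : N.eRk G ≤ N.eRk F := by
    rw [← coe_setRk, ← coe_setRk]; exact_mod_cast h
  have := (N.isRkFinite_of_finite
    (Set.toFinite F)).closure_eq_closure_of_subset_of_eRk_ge_eRk hFG he
  rwa [hF.closure, hG.closure] at this

theorem setRk_closure_insert {N : Matroid α} (hN : N.E = univ) {F : Set α} (hF : N.IsFlat F)
    {e : α} (he : e ∉ F) : setRk N (N.closure (insert e F)) = setRk N F + 1 := by
  have h : N.eRk (insert e F) = N.eRk F + 1 :=
    Matroid.eRk_insert_eq_add_one ⟨by simp [hN], by rwa [hF.closure]⟩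
  rw [← N.eRk_closure_eq, ← coe_setRk, ← coe_setRk] at h
  exact_mod_cast h

/-- A flat of rank one more is a cover, so any new element of it generates it over `F`. This turns
covering members of a chain into the closures `N.closure (insert e F)` that occur in the axioms of a
cut. -/
theorem closure_insert_eq_of_setRk {N : Matroid α} (hN : N.E = univ) {F G : Set α}
    (hF : N.IsFlat F) (hG : N.IsFlat G) (hFG : F ⊆ G) (h : setRk N G = setRk N F + 1) {e : α}
    (heG : e ∈ G) (heF : e ∉ F) : N.closure (insert e F) = G :=
  eq_of_setRk_le (N.isFlat_closure _) hG (closure_sub hG (insert_subset heG hFG))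
    (by rw [setRk_closure_insert hN hF heF, h])

/-- A chain of flats that misses exactly one rank has exactly one gap. -/
theorem exists_gap {N : Matroid α} {C : Finset (Set α)} (hC : IsChain (· ⊆ ·) (C : Set (Set α)))
    (h0 : ∅ ∈ C) (h1 : univ ∈ C) (hfl : ∀ F ∈ C, N.IsFlat F) (hcard : C.card = rk N) :
    ∃ D ∈ C, ∃ D' ∈ C, setRk N D' = setRk N D + 2 ∧ (∀ X ∈ C, X ⊆ D ∨ D' ⊆ X) ∧
      ∀ X ∈ C, X ≠ D → X ≠ univ → ∃ Y ∈ C, X ⊆ Y ∧ setRk N Y = setRk N X + 1 := by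
  classical
  have hle : ∀ X ∈ C, ∀ Y ∈ C, setRk N X ≤ setRk N Y → X ⊆ Y := by
    intro X hX Y hY h
    rcases hC.total hX hY with h' | h'
    · exact h'
    · exact (eq_of_setRk_le (hfl Y hY) (hfl X hX) h' h).symm.subset
  have hinj : Set.InjOn (setRk N) C := fun X hX Y hY h =>
    (hle X hX Y hY h.le).antisymm (hle Y hY X hX h.ge)
  have hlt : ∀ X : Set α, setRk N X ≤ rk N := fun X => by
    rw [← setRk_univ]; exact setRk_mono N (subset_univ X)
  have himg : C.image (setRk N) ⊆ Finset.range (rk N + 1) := by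
    intro j hj
    obtain ⟨X, -, rfl⟩ := Finset.mem_image.1 hj
    exact Finset.mem_range.2 (Nat.lt_succ_of_le (hlt X))
  -- Members of the chain have distinct ranks among the rk N + 1 values 0, …, rk N, and there are
  -- only rk N members. So one value `k` is missed; it is neither 0 nor rk N, as `∅` and `univ` are
  -- present, and the gap runs from rank k - 1 to rank k + 1.
  have hone : (Finset.range (rk N + 1) \ C.image (setRk N)).card = 1 := by
    rw [Finset.card_sdiff_of_subset himg, Finset.card_image_of_injOn hinj, hcard,
      Finset.card_range]
    omega
  obtain ⟨k, hk⟩ := Finset.card_eq_one.1 hone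
  have hmem : ∀ j, (j ≤ rk N ∧ ∀ X ∈ C, setRk N X ≠ j) ↔ j = k := by
    intro j
    rw [← Finset.mem_singleton, ← hk, Finset.mem_sdiff, Finset.mem_range, Nat.lt_succ_iff,
      Finset.mem_image]
    push Not
    rfl
  have hkC := (hmem k).2 rfl
  have hex : ∀ j, j ≤ rk N → j ≠ k → ∃ X ∈ C, setRk N X = j := by
    intro j hj hjk
    by_contra! h
    exact hjk ((hmem j).1 ⟨hj, h⟩)
  have hk0 := hkC.2 ∅ h0
  have hk1 := hkC.2 univ h1
  rw [setRk_empty] at hk0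
  rw [setRk_univ] at hk1
  obtain ⟨D, hD, hDk⟩ := hex (k - 1) (by omega) (by omega)
  obtain ⟨D', hD', hDk'⟩ := hex (k + 1) (by omega) (by omega)
  refine ⟨D, hD, D', hD', by omega, fun X hX => ?_, fun X hX hXD hXu => ?_⟩
  · have := hkC.2 X hX
    rcases Nat.lt_or_gt_of_ne this with h | h
    · exact Or.inl (hle X hX D hD (by omega))
    · exact Or.inr (hle D' hD' X hX (by omega))
  · have h2 : setRk N X ≠ rk N := fun h => hXu (hinj hX h1 (by rw [h, setRk_univ]))
    have h3 : setRk N X ≠ k - 1 := fun h => hXD (hinj hX hD (by rw [h, hDk]))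
    obtain ⟨Y, hY, hYr⟩ := hex (setRk N X + 1) (by have := hlt X; omega) (by omega)
    exact ⟨Y, hY, hle X hX Y hY (by omega), hYr⟩

/-- `Q` is the elementary quotient of `N` that belongs to the modular cut of flats in `𝓜`. -/
structure IsElementaryQuotient (Q N : Matroid α) (𝓜 : Set (Set α)) : Prop where
  empty_notMem : ∅ ∉ 𝓜
  univ_mem : univ ∈ 𝓜
  mono : ∀ {X Y}, X ∈ 𝓜 → X ⊆ Y → Y ∈ 𝓜
  -- The flats `D'` and `N.closure (insert e D)` form a modular pair with intersection `D`. Modular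
  -- pairs of this shape are the only ones needed.
  modular : ∀ {D D' e}, N.IsFlat D → N.IsFlat D' → D ⊆ D' → e ∉ D' → D' ∈ 𝓜 →
    N.closure (insert e D) ∈ 𝓜 → D ∈ 𝓜
  rk_add_one : rk Q + 1 = rk N
  isFlat_iff : ∀ {F}, Q.IsFlat F ↔
    N.IsFlat F ∧ (F ∈ 𝓜 ∨ ∀ e ∉ F, N.closure (insert e F) ∉ 𝓜)

open Classical in
/-- The chains of flats of an elementary quotient depend linearly on the modular cut. -/
theorem exists_linear_flagInd {N : Matroid α} (hN : N.E = univ) (C : Finset (Set α)) :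
    ∃ V : (Set α → ℤ) →ₗ[ℤ] ℤ, ∀ (Q : Matroid α) (𝓜 : Set (Set α)),
      IsElementaryQuotient Q N 𝓜 → flagInd Q C = V (fun X => if X ∈ 𝓜 then 1 else 0) := by
  -- A complete chain of `Q` has rk Q + 1 = rk N members, and all of them are flats of `N`. Any
  -- other `C` has coordinate zero for every quotient.
  by_cases hC : (IsChain (· ⊆ ·) (C : Set (Set α)) ∧ ∅ ∈ C ∧ univ ∈ C) ∧ C.card = rk N ∧
    ∀ F ∈ C, N.IsFlat F
  swap
  · refine ⟨0, fun Q 𝓜 h => ?_⟩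
    rw [LinearMap.zero_apply, flagInd, if_neg]
    rintro ⟨h1, h2, h3⟩
    exact hC ⟨h1, by rw [h2, h.rk_add_one], fun F hF => (h.isFlat_iff.1 (h3 F hF)).1⟩
  obtain ⟨⟨hch, h0, h1⟩, hcard, hfl⟩ := hC
  obtain ⟨D, hD, D', hD', hrk, hsplit, hnext⟩ := exists_gap hch h0 h1 hfl hcard
  have hDD' : D ⊆ D' := by
    rcases hsplit D' hD' with h | h
    · have := setRk_mono N h; omega
    · rcases hsplit D hD with h' | h'
      · rcases hch.total hD hD' with h | h
        · exact h
        · have := setRk_mono N h; omega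
      · have := setRk_mono N h'; omega
  obtain ⟨S, hS⟩ : ∃ S : Finset (Set α), ∀ F, F ∈ S ↔
      N.IsFlat F ∧ D ⊆ F ∧ F ⊆ D' ∧ setRk N F = setRk N D + 1 :=
    ⟨(Set.toFinite {F | N.IsFlat F ∧ D ⊆ F ∧ F ⊆ D' ∧ setRk N F = setRk N D + 1}).toFinset,
      by simp⟩
  -- If `D` is in the cut, so are `D'` and all of `S`, and the value is 1 + (|S| - 1) - |S| = 0. If
  -- `D'` is not in the cut, all terms vanish. In the remaining case the value is 1 minus the number
  -- of members of `S` in the cut. The functional does not involve `Q` or the cut.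
  refine ⟨gapValue S D D', fun Q 𝓜 h => ?_⟩
  have hflag : flagInd Q C = if ∀ F ∈ C, Q.IsFlat F then 1 else 0 := by
    rw [flagInd]
    refine if_congr ⟨fun h => h.2.2, fun h' => ⟨⟨hch, h0, h1⟩, ?_, h'⟩⟩ rfl rfl
    rw [hcard, h.rk_add_one]
  rw [hflag, gapValue_apply]
  -- the largest member of the chain outside the modular cut
  obtain ⟨K, hKC, hK, hmax⟩ : ∃ K ∈ C, K ∉ 𝓜 ∧ ∀ F ∈ C, F ∉ 𝓜 → F ⊆ K := by
    obtain ⟨K, hK⟩ := (C.filter (· ∉ 𝓜)).exists_maximal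
      ⟨∅, Finset.mem_filter.2 ⟨h0, h.empty_notMem⟩⟩
    have hK1 := Finset.mem_filter.1 hK.prop
    refine ⟨K, hK1.1, hK1.2, fun F hF hFM => ?_⟩
    rcases hch.total hF hK1.1 with h | h
    · exact h
    · exact hK.le_of_ge (Finset.mem_filter.2 ⟨hF, hFM⟩) h
  by_cases hKD : K = D
  swap
  -- Here the next member `Y` of the chain covers `K` in `N` and lies in the cut by maximality of
  -- `K`, so `K` is not a flat of `Q` and the coordinate is zero. Both `D` and `D'` are on the same
  -- side of the cut, so the functional vanishes as well.
  · obtain ⟨Y, hY, hKY, hYr⟩ := hnext K hKC hKD (fun he => hK (he ▸ h.univ_mem))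
    have hYK : ¬ Y ⊆ K := fun hYK => by have := setRk_mono N hYK; omega
    have hYM : Y ∈ 𝓜 := by
      by_contra hYM; exact hYK (hmax Y hY hYM)
    obtain ⟨e, heY, heK⟩ := not_subset.1 hYK
    have hcl := closure_insert_eq_of_setRk hN (hfl K hKC) (hfl Y hY) hKY hYr heY heK
    rw [if_neg]
    swap
    · intro hf
      rcases (h.isFlat_iff.1 (hf K hKC)).2 with h' | h'
      · exact hK h'
      · exact h' e heK (hcl ▸ hYM)
    rcases hsplit K hKC with hs | hs
    · have hDM : D ∈ 𝓜 := by
        by_contra hDM; exact hKD (hs.antisymm (hmax D hD hDM))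
      rw [if_pos (h.mono hDM hDD'), if_pos hDM,
        Finset.sum_congr rfl fun F hF => if_pos (h.mono hDM ((hS F).1 hF).2.1)]
      simp
    · have hDM : D' ∉ 𝓜 := fun hDM => hK (h.mono hDM hs)
      rw [if_neg hDM, if_neg (fun h' => hDM (h.mono h' hDD')),
        Finset.sum_congr rfl fun F hF => if_neg (fun h' => hDM (h.mono h' ((hS F).1 hF).2.2.1))]
      simp
  subst hKD
  -- From here on the cut separates the two ends of the gap: `K` is the lower end and lies outside
  -- the cut.
  have hDM' : D' ∈ 𝓜 := by
    by_contra hDM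
    have := setRk_mono N (hmax D' hD' hDM)
    omega
  have hpick : ∀ F ∈ S, ∀ e ∈ F, e ∉ K → N.closure (insert e K) = F := fun F hF e heF heK => by
    have hF' := (hS F).1 hF
    exact closure_insert_eq_of_setRk hN (hfl K hKC) hF'.1 hF'.2.1 hF'.2.2.2 heF heK
  rw [if_pos hDM', if_neg hK, mul_zero, add_zero]
  -- A member of `S` in the cut is a cover of `K`, so it prevents `K` from being a flat of `Q`. It
  -- is the only such member: a second one, `G`, is the closure of `insert g K` with `g` outside
  -- `F`, and modularity would put `K` into the cut.
  by_cases hex : ∃ F ∈ S, F ∈ 𝓜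
  · obtain ⟨F, hF, hFM⟩ := hex
    have hF' := (hS F).1 hF
    obtain ⟨e, heF, heK⟩ : ∃ e ∈ F, e ∉ K := not_subset.1 fun hs => by
      have := setRk_mono N hs; omega
    rw [if_neg, Finset.sum_eq_single F, if_pos hFM]
    · rfl
    · intro G hG hGF
      refine if_neg fun hGM => ?_
      have hG' := (hS G).1 hG
      obtain ⟨g, hgG, hgF⟩ : ∃ g ∈ G, g ∉ F := not_subset.1 fun hs =>
        hGF (eq_of_setRk_le hG'.1 hF'.1 hs (by omega))
      refine hK (h.modular (hfl K hKC) hF'.1 hF'.2.1 hgF hFM ?_)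
      rwa [hpick G hG g hgG fun hgK => hgF (hF'.2.1 hgK)]
    · exact fun h => absurd hF h
    · intro hf
      rcases (h.isFlat_iff.1 (hf K hKC)).2 with h' | h'
      · exact hK h'
      · exact h' e heK (by rwa [hpick F hF e heF heK])
  · push Not at hex
    rw [if_pos, Finset.sum_congr rfl fun F hF => if_neg (hex F hF)]
    · simp
    · intro X hX
      -- If a member `X` outside the cut had `N.closure (insert e X)` in the cut, the same would
      -- hold for `K` by monotonicity. Then `e` in `K` contradicts the choice of `K`, `e` in `D'`
      -- but not in `K` gives a member of `S` in the cut, and `e` outside `D'` contradicts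
      -- modularity applied to `D'`.
      refine h.isFlat_iff.2 ⟨hfl X hX, or_iff_not_imp_left.2 fun hXM e heX hcl => ?_⟩
      have hXK := hmax X hX hXM
      have hclK : N.closure (insert e K) ∈ 𝓜 :=
        h.mono hcl (N.closure_subset_closure (insert_subset_insert hXK))
      by_cases heK : e ∈ K
      · rw [insert_eq_of_mem heK, (hfl K hKC).closure] at hclK
        exact hK hclK
      by_cases heD : e ∈ D'
      · exact hex _ ((hS _).2 ⟨N.isFlat_closure _, (subset_insert _ _).trans
          (N.subset_closure _ (by simp [hN])), closure_sub (hfl D' hD') (insert_subset heD hDD'),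
          setRk_closure_insert hN (hfl K hKC) heK⟩) hclK
      · exact hK (h.modular (hfl K hKC) (hfl D' hD') hDD' heD hDM' hclK)

/-- These are the principal cuts. For modularity, an element of `A` outside `D` could be exchanged
with `e`, since both generate the same flat over `D`; that flat would lie in `D'` and `e` with it.
-/
theorem isElementaryQuotient_trunc {A : Set α} (hA : A.Nonempty) {N : Matroid α}
    (hN : N.E = univ) (hl : N.Loopless) : IsElementaryQuotient (trunc A N) N {X | A ⊆ X} where
  empty_notMem := fun h => hA.ne_empty (subset_empty_iff.1 h)
  univ_mem := subset_univ A
  mono := fun h h' => Subset.trans h h'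
  modular := by
    intro D D' e hD hD' hDD' he hAD' hAe x hx
    by_contra hxD
    have hxe := N.closure_insert_congr (X := D) (e := x) (f := e) ⟨hAe hx, by rwa [hD.closure]⟩
    refine he (closure_sub hD' (insert_subset (hAD' hx) hDD') ?_)
    rw [hxe]
    exact N.subset_closure _ (by simp [hN]) (mem_insert _ _)
  rk_add_one := trunc_rk hA hN hl
  isFlat_iff := by
    intro F
    rw [trunc_isFlat hA hN]
    refine and_congr_right fun hF => ⟨fun h => or_iff_not_imp_left.2 fun hAF e he hAe => ?_, ?_⟩
    · obtain ⟨a, ha, haF⟩ := not_subset.1 hAF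
      refine h a ha haF ?_
      rwa [N.closure_insert_congr (X := F) (e := a) (f := e) ⟨hAe ha, by rwa [hF.closure]⟩]
    · rintro (h | h) e he heF
      · exact absurd (h he) heF
      · exact h e heF

/-! ### Expansion of a cut into principal ones. -/

open Classical in
/-- Möbius inversion on the lattice of subsets. -/
theorem exists_sum_subset_eq [Fintype (Set α)] (φ : Set α → ℤ) :
    ∃ c : Set α → ℤ, φ = ∑ A, c A • fun X => if A ⊆ X then (1 : ℤ) else 0 := by
  let c : Set α → ℤ := WellFoundedLT.fix fun S ih => φ S - ∑ T : {T // T < S}, ih T.1 T.2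
  have hc : ∀ S, c S = φ S - ∑ T : {T // T < S}, c T.1 := fun S => WellFoundedLT.fix_eq _ S
  refine ⟨c, funext fun S => ?_⟩
  simp only [Finset.sum_apply, Pi.smul_apply, smul_eq_mul, mul_ite, mul_one, mul_zero]
  rw [← Finset.sum_filter]
  have : Finset.univ.filter (· ⊆ S) = insert S (Finset.univ.filter (· < S)) := by
    ext T
    simp only [Finset.mem_filter, Finset.mem_univ, true_and, Finset.mem_insert]
    exact le_iff_eq_or_lt
  rw [this, Finset.sum_insert (by simp), hc S, ← Finset.sum_subtype_eq_sum_filter]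
  simp

open Classical in
/-- The flag vector of an elementary quotient is a combination of those of principal ones. -/
theorem IsElementaryQuotient.exists_flagInd_eq_sum [Fintype (Set α)] {Q N : Matroid α}
    {𝓜 : Set (Set α)} (h : IsElementaryQuotient Q N 𝓜) (hN : N.E = univ) (hl : N.Loopless) :
    ∃ c : Set α → ℤ, c ∅ = 0 ∧ ∀ C, flagInd Q C = ∑ A, c A * flagInd (trunc A N) C := by
  obtain ⟨c, hc⟩ := exists_sum_subset_eq (fun X => if X ∈ 𝓜 then (1 : ℤ) else 0)
  -- At the empty set only the filter of `∅` contributes, and the cut omits `∅`. This is needed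
  -- because `A = ∅` does not give an elementary quotient.
  have hc0 : c ∅ = 0 := by
    have := congrFun hc ∅
    simpa [h.empty_notMem, Finset.sum_apply, subset_empty_iff] using this.symm
  refine ⟨c, hc0, fun C => ?_⟩
  -- One functional `V` serves `Q` and all the principal quotients at once.
  obtain ⟨V, hV⟩ := exists_linear_flagInd hN C
  rw [hV Q 𝓜 h, hc, map_sum]
  refine Finset.sum_congr rfl fun A _ => ?_
  rcases A.eq_empty_or_nonempty with rfl | hA
  · rw [hc0, zero_smul, map_zero, zero_mul]
  · rw [map_smul, smul_eq_mul, hV _ _ (isElementaryQuotient_trunc hA hN hl)]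
    rfl

end ElementaryQuotient

/-! ### The free lift: every non-free matroid as an elementary quotient. -/

section FreeLift

variable {α : Type*} [Finite α]

/-- The freest matroid that has `M` as an elementary quotient. -/
noncomputable def freeLift (M : Matroid α) : Matroid α := union M (unif 1 univ)

theorem freeLift_ground (M : Matroid α) : (freeLift M).E = univ := by
  rw [freeLift, union_ground, unif_ground, union_univ]

theorem freeLift_indep_insert {M : Matroid α} {I : Set α} (hI : M.Indep I) (e : α) :
    (freeLift M).Indep (insert e I) :=
  union_indep.2 ⟨I, {e}, hI, unif_indep.2 ⟨subset_univ _, by simp⟩, by rw [union_singleton]⟩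

/-- An independent set of `M` stays independent in the lift after adding any one element, so it
spans nothing new. Together with `freeLift_closure_of_not_indep` this describes the flats of the
lift: the independent sets of `M` and the dependent flats of `M`. -/
theorem freeLift_closure_of_indep {M : Matroid α} {I : Set α} (hI : M.Indep I) :
    (freeLift M).closure I = I := by
  have hE := freeLift_ground M
  refine Subset.antisymm (fun x hx => ?_) ((freeLift M).subset_closure _ (by simp [hE]))
  by_contra hxI
  have h := freeLift_indep_insert hI x
  exact ((h.subset (subset_insert _ _)).notMem_closure_iff (by simp [hE])).2 ⟨h, hxI⟩ hx

/-- A basis of `X` in `M` can be enlarged by one further element of `X`, which exists exactly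
because `X` is dependent; the rank one summand cannot supply more. -/
theorem freeLift_eRk {M : Matroid α} (hM : M.E = univ) {X : Set α} (hX : ¬ M.Indep X) :
    (freeLift M).eRk X = M.eRk X + 1 := by
  apply le_antisymm
  · rw [Matroid.eRk_le_iff]
    intro J hJX hJ
    obtain ⟨I, K, hI, hK, rfl⟩ := union_indep.1 hJ
    refine (encard_union_le I K).trans (add_le_add
      (hI.encard_le_eRk_of_subset (subset_union_left.trans hJX)) ?_)
    rw [← (Set.toFinite K).cast_ncard_eq]
    exact_mod_cast (unif_indep.1 hK).2
  · obtain ⟨I, hI⟩ := M.exists_isBasis X (by simp [hM])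
    obtain ⟨f, hfX, hfI⟩ : ∃ f ∈ X, f ∉ I := not_subset.1 fun h =>
      hX (hI.indep.subset h)
    rw [← hI.encard_eq_eRk, ← encard_insert_of_notMem hfI]
    exact (freeLift_indep_insert hI.indep f).encard_le_eRk_of_subset
      (insert_subset hfX hI.subset)

theorem mem_closure_iff_eRk_insert {M : Matroid α} (hM : M.E = univ) {X : Set α} {x : α} :
    x ∈ M.closure X ↔ M.eRk (insert x X) = M.eRk X := by
  constructor
  · intro h
    rw [← M.eRk_closure_eq, M.closure_insert_eq_of_mem_closure h, M.eRk_closure_eq]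
  · intro h
    by_contra hx
    rw [Matroid.eRk_insert_eq_add_one ⟨by simp [hM], hx⟩, ← coe_setRk] at h
    have : setRk M X + 1 = setRk M X := by exact_mod_cast h
    omega

/-- Dependence passes to supersets, so the ranks of `X` and of `insert x X` are both shifted by one,
and whether they agree does not change. -/
theorem freeLift_closure_of_not_indep {M : Matroid α} (hM : M.E = univ) {X : Set α}
    (hX : ¬ M.Indep X) : (freeLift M).closure X = M.closure X := by
  ext x
  rw [mem_closure_iff_eRk_insert hM, mem_closure_iff_eRk_insert (freeLift_ground M), freeLift_eRk hM hX,
    freeLift_eRk hM fun h => hX (h.subset (subset_insert _ _))]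
  rw [← coe_setRk, ← coe_setRk]
  norm_cast
  omega

theorem freeLift_loopless (M : Matroid α) : (freeLift M).Loopless :=
  ⟨freeLift_closure_of_indep M.empty_indep⟩

theorem freeLift_closure_indep_iff {M : Matroid α} {X : Set α} :
    M.Indep ((freeLift M).closure X) ↔ M.Indep X := by
  refine ⟨fun h => h.subset ((freeLift M).subset_closure _ (by simp [freeLift_ground])),
    fun h => by rwa [freeLift_closure_of_indep h]⟩

/-- The cut consists of the dependent sets of `M`. For modularity: if `D` is independent and `insert
e D` is not, then `e` is in the `M`-closure of `D`, hence in that of the dependent set `D'`, where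
the two closures agree. An independent `F` is a flat of `M` precisely when no single added element
makes it dependent, which is the cover condition. -/
theorem isElementaryQuotient_freeLift {M : Matroid α} (hM : M.E = univ) (hu : ¬ M.Indep univ) :
    IsElementaryQuotient M (freeLift M) {X | ¬ M.Indep X} where
  empty_notMem := fun h => h M.empty_indep
  univ_mem := hu
  mono := fun h hXY hY => h (hY.subset hXY)
  modular := by
    intro D D' e _ hD' hDD' he hD'M hcl hD
    change ¬ M.Indep D' at hD'M
    change ¬ M.Indep ((freeLift M).closure (insert e D)) at hcl
    rw [freeLift_closure_indep_iff] at hcl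
    have heD : e ∈ M.closure D := by
      by_contra h
      exact hcl (hD.insert_indep_iff.2 (Or.inl ⟨by simp [hM], h⟩))
    have := M.closure_subset_closure hDD' heD
    rw [← freeLift_closure_of_not_indep hM hD'M, hD'.closure] at this
    exact he this
  rk_add_one := by
    have h := freeLift_eRk hM hu
    rw [Matroid.eRk_univ_eq, Matroid.eRk_univ_eq, ← coe_rk, ← coe_rk] at h
    exact_mod_cast h.symm
  isFlat_iff := by
    intro F
    by_cases hF : M.Indep F
    · have hfl : (freeLift M).IsFlat F := by
        rw [Matroid.isFlat_iff_closure_eq, freeLift_closure_of_indep hF]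
      simp only [mem_ofPred_eq, hF, hfl, not_true, false_or, true_and, not_not,
        freeLift_closure_indep_iff]
      rw [MatroidIntersection.isFlat_iff hM]
      refine forall₂_congr fun e he => ?_
      rw [hF.insert_indep_iff_of_notMem he, hM]
      simp
    · simp only [mem_ofPred_eq, hF, not_false_eq_true, true_or, and_true,
        Matroid.isFlat_iff_closure_eq, freeLift_closure_of_not_indep hM hF]

end FreeLift

/-! ### Generation by corank one matroids. -/

section Generation

theorem cls_trunc {n : ℕ} {N : Matroid (Fin n)} (hN : N.E = univ) (A : Set (Fin n)) :
    cls (trunc A N) = cls N * cls (corankOne Aᶜ) :=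
  (cls_mul_cls hN (corankOne_ground _)).symm

/-- The element `a` becomes a loop. This discards exactly those `A` whose complement has n - 1
elements, which is too many for a generator. -/
theorem cls_trunc_singleton {n : ℕ} {N : Matroid (Fin n)} (hN : N.E = univ) (a : Fin n) :
    cls (trunc {a} N) = 0 := by
  refine cls_eq_zero fun h => ?_
  have h' := (trunc_isFlat (singleton_nonempty a) hN).1 (loopless_iff.1 h.2.1)
  refine h'.2 a rfl (notMem_empty _) ?_
  rw [insert_empty_eq]
  exact N.subset_closure _ (by simp [hN])

theorem compl_ncard_add_two_le {n : ℕ} {A : Set (Fin n)} (hA : A.Nontrivial) :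
    Aᶜ.ncard + 2 ≤ n := by
  have h1 := ncard_add_ncard_compl A
  rw [Nat.card_eq_fintype_card, Fintype.card_fin] at h1
  have h2 := one_lt_ncard_iff_nontrivial.2 hA
  omega

/-- The products of the classes of corank one matroids. -/
def corankOneProducts (n : ℕ) : Set (MatroidRing n) :=
  {x | ∃ l : List (Set (Fin n)), (∀ G ∈ l, G.ncard + 2 ≤ n) ∧
    x = (l.map (fun G => cls (corankOne G))).prod}

theorem mul_mem_span_corankOneProducts {n : ℕ} {x : MatroidRing n}
    (hx : x ∈ Submodule.span ℤ (corankOneProducts n)) {G : Set (Fin n)} (hG : G.ncard + 2 ≤ n) :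
    x * cls (corankOne G) ∈ Submodule.span ℤ (corankOneProducts n) := by
  induction hx using Submodule.span_induction with
  | mem x hx =>
    obtain ⟨l, hl, rfl⟩ := hx
    refine Submodule.subset_span ⟨G :: l, ?_, ?_⟩
    · intro G' hG'
      rcases List.mem_cons.1 hG' with rfl | h
      · exact hG
      · exact hl G' h
    · rw [List.map_cons, List.prod_cons, mul_comm]
  | zero => rw [zero_mul]; exact Submodule.zero_mem _
  | add x y _ _ hx hy => rw [add_mul]; exact Submodule.add_mem _ hx hy
  | smul a x _ hx => rw [smul_mul_assoc]; exact Submodule.smul_mem _ a hx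

/-- Recursion on the corank: the class of `M` is a combination of products of the class of its free
lift with corank one classes, and the lift has smaller corank. -/
theorem cls_mem_span_corankOneProducts {n : ℕ} (M : Matroid (Fin n)) (hM : M.E = univ) :
    cls M ∈ Submodule.span ℤ (corankOneProducts n) := by
  classical
  -- If the whole ground set is independent, `M` is free and its class is the empty product.
  -- Otherwise `univ` is dependent and the free lift has larger rank.
  by_cases hu : M.Indep univ
  · have : M = Matroid.freeOn univ := Matroid.ext_indep (by simp [hM]) fun X _ => by
      simp [hu.subset (subset_univ X)]
    rw [this, ← one_def]
    exact Submodule.subset_span ⟨[], by simp, by simp⟩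
  have hq := isElementaryQuotient_freeLift hM hu
  have hN := freeLift_ground M
  have hrk : rk (freeLift M) ≤ n := by
    have := rk_le_of_spanning (freeLift M).ground_spanning
    rwa [hN, ncard_univ, Nat.card_eq_fintype_card, Fintype.card_fin] at this
  have hrk' := hq.rk_add_one
  have ih := cls_mem_span_corankOneProducts (freeLift M) hN
  obtain ⟨c, hc0, hc⟩ := hq.exists_flagInd_eq_sum hN (freeLift_loopless M)
  -- Elements of the ring are determined by their chain coordinates, so the identity of chain
  -- vectors is an identity of classes.
  have hsum : cls M = ∑ A, c A • cls (trunc A (freeLift M)) := by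
    rw [← sub_eq_zero]
    refine eq_zero_of_coord fun r C => ?_
    rw [map_sub, map_sum, coord_cls r C hM, hc, sub_eq_zero]
    exact Finset.sum_congr rfl fun A _ => by
      rw [map_zsmul, coord_cls r C (trunc_ground hN), smul_eq_mul]
  rw [hsum]
  refine Submodule.sum_mem _ fun A _ => ?_
  rcases A.eq_empty_or_nonempty with rfl | hA
  · rw [hc0, zero_smul]; exact Submodule.zero_mem _
  refine Submodule.smul_mem _ _ ?_
  rcases hA.exists_eq_singleton_or_nontrivial with ⟨a, rfl⟩ | hA
  · rw [cls_trunc_singleton hN]; exact Submodule.zero_mem _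
  · rw [cls_trunc hN]
    exact mul_mem_span_corankOneProducts ih (compl_ncard_add_two_le hA)
termination_by n - rk M
decreasing_by omega

/-- The free matroid is neutral for intersection. Loops and rank of a corank one matroid can thus be
read off from the general facts on `trunc`. -/
theorem corankOne_eq_trunc_free {α : Type*} [Finite α] (G : Set α) :
    corankOne G = trunc Gᶜ (Matroid.freeOn univ) := by
  rw [trunc, compl_compl, inter_comm', inter_free (corankOne_ground G)]

/-- In the free matroid a single element does not span a set with two elements, so no element of
`Gᶜ` becomes a loop. -/
theorem corankOne_loopless {α : Type*} [Finite α] {G : Set α} (hG : Gᶜ.Nontrivial) :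
    (corankOne G).Loopless := by
  rw [corankOne_eq_trunc_free, loopless_iff, trunc_isFlat hG.nonempty (by simp)]
  refine ⟨by simp [Matroid.isFlat_iff_closure_eq], fun e _ _ h => ?_⟩
  rw [Matroid.freeOn_closure_eq, inter_univ, insert_empty_eq] at h
  exact hG.not_subset_singleton h

theorem corankOne_eRank_add_one {n : ℕ} {G : Set (Fin n)} (hG : Gᶜ.Nonempty) :
    (corankOne G).eRank + 1 = n := by
  have h : rk (trunc Gᶜ (Matroid.freeOn univ)) + 1 = rk (Matroid.freeOn (univ : Set (Fin n))) :=
    trunc_rk hG (by simp) (loopless_iff.2 (by simp [Matroid.isFlat_iff_closure_eq]))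
  have h' : (rk (Matroid.freeOn (univ : Set (Fin n))) : ℕ∞) = n := by
    rw [coe_rk, Matroid.eRank_freeOn, encard_univ]; simp
  rw [← coe_rk, corankOne_eq_trunc_free, ← h', ← h]
  simp

end Generation

end MatroidIntersection

theorem mainTheorem4 (n : ℕ) (hn : 1 ≤ n) :
    Algebra.adjoin ℤ {x : MatroidIntersection.MatroidRing n | ∃ H : Matroid (Fin n),
        H.E = Set.univ ∧ H.Loopless ∧ H.eRank + 1 = n ∧ x = MatroidIntersection.cls H} = ⊤ ∧
    ∀ M : Matroid (Fin n), M.E = Set.univ → M.Loopless →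
      MatroidIntersection.cls M ∈
        Submodule.span ℤ {x : MatroidIntersection.MatroidRing n | ∃ l : List (Set (Fin n)),
          (∀ G ∈ l, G.ncard + 2 ≤ n) ∧
            x = (l.map (fun G =>
              MatroidIntersection.cls (MatroidIntersection.corankOne G))).prod} := by
  refine ⟨?_, fun M hM _ => MatroidIntersection.cls_mem_span_corankOneProducts M hM⟩
  rw [eq_top_iff]
  rintro x -
  -- The classes of matroids generate the ring additively, so the statement on the algebra follows
  -- from the statement on spans, once the corank one factors are seen to be loopfree of rank n - 1.
  induction x using MatroidIntersection.induction_cls with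
  | h M hM =>
    have h := MatroidIntersection.cls_mem_span_corankOneProducts M hM
    rw [← Subalgebra.mem_toSubmodule]
    refine Submodule.span_le.2 ?_ h
    rintro _ ⟨l, hl, rfl⟩
    rw [SetLike.mem_coe, Subalgebra.mem_toSubmodule]
    refine list_prod_mem fun y hy => ?_
    obtain ⟨G, hG, rfl⟩ := List.mem_map.1 hy
    have hc : Gᶜ.Nontrivial := by
      rw [← Set.one_lt_ncard_iff_nontrivial]
      have h1 := Set.ncard_add_ncard_compl G
      rw [Nat.card_eq_fintype_card, Fintype.card_fin] at h1
      have := hl G hG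
      omega
    exact Algebra.subset_adjoin ⟨_, MatroidIntersection.corankOne_ground G,
      MatroidIntersection.corankOne_loopless hc,
      MatroidIntersection.corankOne_eRank_add_one hc.nonempty, rfl⟩
  | h0 => exact zero_mem _
  | hadd x y hx hy => exact add_mem hx hy
  | hneg x hx => exact neg_mem hx
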